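/- Let $V:\mathbb Z\to\mathbb R$ be bounded and let $H$ be the operator $[Hu](n)=u(n+1)+u(n-1)+V(n)u(n)$ on $\ell^2(\mathbb Z)$. Let $K\ge 4$ be such that $\sigma(H)\subseteq[-K+1,K-1]$. For $n\in\mathbb Z$ and $z\in\mathbb C$ let $$\Phi(n,z)=\begin{cases}T(n,z)\cdots T(1,z)& n\ge1,\\ \mathrm{Id}& n=0,\\ T(n+1,z)^{-1}\cdots T(0,z)^{-1}& n\le-1,\end{cases}\qquad T(m,z)=\begin{pmatrix}z-V(m)&-1\\1&0\end{pmatrix},$$ and let $\|\cdot\|$ denote the operator norm of matrices on $\mathbb C^2$ with its Euclidean norm. For real $N$ and $t>0$ put $$P(N,t)=\sum_{n\le -N}|\langle e^{-itH}\delta_0,\delta_n\rangle|^2+\sum_{n\ge N}|\langle e^{-itH}\delta_0,\delta_n\rangle|^2 ,$$ and, with $\log 0=-\infty$, define $$S^+(a)=-\limsup_{t\to\infty}\frac{\log P(t^{a}-1,t)}{\log t}\quad(a\ge 0),\qquad \alpha_u^+=\sup\{a\ge0: S^+(a)<\infty\},$$ $$\beta^+_{\delta_0}(p)=\limsup_{t\to\infty}\frac{1}{p\log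 t}\,\log\sum_{n\in\mathbb Z}|n|^p\,|\langle e^{-itH}\delta_0,\delta_n\rangle|^2\qquad(p>0).$$ Suppose that for some $C\in(0,\infty)$ and $\alpha\in(0,1)$ we have, for every integer $m\ge1$, as $t\to\infty$, $$\int_{-K}^{K}\Bigl(\max_{1\le n\le Ct^\alpha}\|\Phi(n,E+it^{-1})\|^2\Bigr)^{-1}dE=O(t^{-m})$$ and $$\int_{-K}^{K}\Bigl(\max_{1\le -n\le Ct^\alpha}\|\Phi(n,E+it^{-1})\|^2\Bigr)^{-1}dE=O(t^{-m}).$$ Then $\alpha_u^+\le\alpha$. In particular, $\beta^+_{\delta_0}(p)\le\alpha$ for every $p>0$. -/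

import Mathlib

open Filter Topology Asymptotics
open scoped NNReal ENNReal

noncomputable section

namespace Schrodinger

/-- The Hilbert space `ℓ²(ℤ)` of square-summable complex sequences. -/
abbrev L2Z : Type := lp (fun _ : ℤ => ℂ) 2

/-- The standard basis vector `δ_n` of `ℓ²(ℤ)`. -/
def delta (n : ℤ) : L2Z := lp.single 2 n (1 : ℂ)

theorem memlp_shift (k : ℤ) (u : L2Z) : Memℓp (fun n : ℤ => u (n + k)) 2 := by
  have h := (memℓp_gen_iff (by norm_num)).1 (lp.memℓp u)
  exact (memℓp_gen_iff (by norm_num)).2 (h.comp_injective (add_left_injective k))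

/-- The translation `(S_k u)(n) = u(n + k)` on `ℓ²(ℤ)`. -/
def shiftOp (k : ℤ) : L2Z →L[ℂ] L2Z :=
  LinearMap.mkContinuous
    { toFun := fun u => ⟨fun n : ℤ => u (n + k), memlp_shift k u⟩
      map_add' := fun u v => by ext n; simp; rfl
      map_smul' := fun c u => by ext n; simp }
    1 (fun u => by
      rw [one_mul, lp.norm_eq_tsum_rpow (by norm_num), lp.norm_eq_tsum_rpow (by norm_num)]
      refine le_of_eq (congrArg (fun x : ℝ => x ^ (1 / (2 : ℝ≥0∞).toReal)) ?_)
      exact (Equiv.addRight k).tsum_eq (fun n : ℤ => ‖u n‖ ^ (2 : ℝ≥0∞).toReal))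

theorem norm_potential_mul_le {V : ℤ → ℝ} {M : ℝ} (hM : ∀ n, |V n| ≤ M) (u : L2Z) (n : ℤ) :
    ‖(V n : ℂ) * u n‖ ≤ ‖((M : ℂ) • u) n‖ := by
  have hM0 : 0 ≤ M := (abs_nonneg _).trans (hM 0)
  rw [lp.coeFn_smul, Pi.smul_apply, smul_eq_mul, norm_mul, norm_mul, Complex.norm_real,
    Complex.norm_real, Real.norm_eq_abs, Real.norm_eq_abs, abs_of_nonneg hM0]
  exact mul_le_mul_of_nonneg_right (hM n) (norm_nonneg _)

theorem memlp_potential_mul {V : ℤ → ℝ} (hV : ∃ M : ℝ, ∀ n, |V n| ≤ M) (u : L2Z) :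
    Memℓp (fun n : ℤ => (V n : ℂ) * u n) 2 := by
  obtain ⟨M, hM⟩ := hV
  have hs := (memℓp_gen_iff (by norm_num)).1 (lp.memℓp ((M : ℂ) • u))
  refine (memℓp_gen_iff (by norm_num)).2 (hs.of_nonneg_of_le (fun n => by positivity) fun n => ?_)
  exact Real.rpow_le_rpow (norm_nonneg _) (norm_potential_mul_le hM u n) (by norm_num)

/-- Multiplication by the bounded real function `V` on `ℓ²(ℤ)`. -/
def potentialOp (V : ℤ → ℝ) (hV : ∃ M : ℝ, ∀ n, |V n| ≤ M) : L2Z →L[ℂ] L2Z :=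
  LinearMap.mkContinuousOfExistsBound
    { toFun := fun u => ⟨fun n : ℤ => (V n : ℂ) * u n, memlp_potential_mul hV u⟩
      map_add' := fun u v => by ext n; simp [mul_add]; rfl
      map_smul' := fun c u => by ext n; simp [mul_left_comm] }
    (by
      obtain ⟨M, hM⟩ := id hV
      have hM0 : 0 ≤ M := (abs_nonneg _).trans (hM 0)
      refine ⟨M, fun u => ?_⟩
      have h2 : ‖(M : ℂ) • u‖ = M * ‖u‖ := by
        rw [norm_smul, Complex.norm_real, Real.norm_eq_abs, abs_of_nonneg hM0]
      rw [← h2, lp.norm_eq_tsum_rpow (by norm_num) ((M : ℂ) • u)]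
      rw [lp.norm_eq_tsum_rpow (by norm_num)]
      refine Real.rpow_le_rpow (tsum_nonneg fun n => by positivity) ?_ (by norm_num)
      refine Summable.tsum_le_tsum (fun n => ?_)
        ((memℓp_gen_iff (by norm_num)).1 (memlp_potential_mul hV u))
        ((memℓp_gen_iff (by norm_num)).1 (lp.memℓp ((M : ℂ) • u)))
      exact Real.rpow_le_rpow (norm_nonneg _) (norm_potential_mul_le hM u n) (by norm_num))

/-- The discrete Schrödinger operator with bounded real potential `V`, a bounded operator on
`ℓ²(ℤ)`; its pointwise formula is `hamiltonian_apply`. -/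
def hamiltonian (V : ℤ → ℝ) (hV : ∃ M : ℝ, ∀ n, |V n| ≤ M) : L2Z →L[ℂ] L2Z :=
  shiftOp 1 + shiftOp (-1) + potentialOp V hV

theorem hamiltonian_apply (V : ℤ → ℝ) (hV : ∃ M : ℝ, ∀ n, |V n| ≤ M) (u : L2Z) (n : ℤ) :
    hamiltonian V hV u n = u (n + 1) + u (n - 1) + (V n : ℂ) * u n :=
  rfl

/-- The solution `ψ(t) = e^{-itH} δ_0` of the Schrödinger equation started at `δ_0`. -/
def psi (V : ℤ → ℝ) (hV : ∃ M : ℝ, ∀ n, |V n| ≤ M) (t : ℝ) : L2Z :=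
  NormedSpace.exp ((-(Complex.I * (t : ℂ))) • hamiltonian V hV) (delta 0)

/-- The probability `|⟨e^{-itH} δ_0, δ_n⟩|²`. -/
def prob (V : ℤ → ℝ) (hV : ∃ M : ℝ, ∀ n, |V n| ≤ M) (t : ℝ) (n : ℤ) : ℝ :=
  ‖inner ℂ (delta n) (psi V hV t)‖ ^ 2

/-- `P_r(N,t)`, for real `N`: the sum of the probabilities over all `n ≥ N`. -/
def probRight (V : ℤ → ℝ) (hV : ∃ M : ℝ, ∀ n, |V n| ≤ M) (N t : ℝ) : ℝ≥0∞ :=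
  ∑' n : {n : ℤ // N ≤ (n : ℝ)}, ENNReal.ofReal (prob V hV t n)

/-- `P_l(N,t)`, for real `N`: the sum of the probabilities over all `n ≤ -N`. -/
def probLeft (V : ℤ → ℝ) (hV : ∃ M : ℝ, ∀ n, |V n| ≤ M) (N t : ℝ) : ℝ≥0∞ :=
  ∑' n : {n : ℤ // (n : ℝ) ≤ -N}, ENNReal.ofReal (prob V hV t n)

/-- The outside probability `P(N,t) = P_l(N,t) + P_r(N,t)`. -/
def probOutside (V : ℤ → ℝ) (hV : ∃ M : ℝ, ∀ n, |V n| ≤ M) (N t : ℝ) : ℝ≥0∞ :=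
  probLeft V hV N t + probRight V hV N t

/-- `S⁺(a) = - limsup_{t → ∞} log P(t^a - 1, t) / log t`, as an extended real number; here
`log 0 = -∞`. -/
def SPlus (V : ℤ → ℝ) (hV : ∃ M : ℝ, ∀ n, |V n| ≤ M) (a : ℝ) : EReal :=
  -limsup (fun t : ℝ => ENNReal.log (probOutside V hV (t ^ a - 1) t) / ((Real.log t : ℝ) : EReal))
    atTop

/-- `α_u⁺ = sup {a ≥ 0 : S⁺(a) < ∞}`. -/
def alphaUPlus (V : ℤ → ℝ) (hV : ∃ M : ℝ, ∀ n, |V n| ≤ M) : EReal :=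
  sSup {x : EReal | ∃ a : ℝ, x = (a : EReal) ∧ 0 ≤ a ∧ SPlus V hV a < ⊤}

/-- The `p`-th moment of the position operator, `∑_n |n|^p |⟨e^{-itH} δ_0, δ_n⟩|²`. -/
def moment (V : ℤ → ℝ) (hV : ∃ M : ℝ, ∀ n, |V n| ≤ M) (p t : ℝ) : ℝ≥0∞ :=
  ∑' n : ℤ, ENNReal.ofReal (|(n : ℝ)| ^ p * prob V hV t n)

/-- The upper transport exponent
`β⁺_{δ_0}(p) = limsup_{t → ∞} log ⟨|X|^p_{δ_0}⟩(t) / (p log t)`. -/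
def betaPlus (V : ℤ → ℝ) (hV : ∃ M : ℝ, ∀ n, |V n| ≤ M) (p : ℝ) : EReal :=
  limsup (fun t : ℝ => ENNReal.log (moment V hV p t) / ((p * Real.log t : ℝ) : EReal)) atTop

/-- The one-step transfer matrix `T(m,z)`. -/
def stepMatrix (V : ℤ → ℝ) (z : ℂ) (m : ℤ) : Matrix (Fin 2) (Fin 2) ℂ :=
  !![z - (V m : ℂ), -1; 1, 0]

/-- `Φ(n,z) = T(n,z) ⋯ T(1,z)` for `n ≥ 0`. -/
def transferPos (V : ℤ → ℝ) (z : ℂ) : ℕ → Matrix (Fin 2) (Fin 2) ℂ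
  | 0 => 1
  | n + 1 => stepMatrix V z ((n : ℤ) + 1) * transferPos V z n

/-- `Φ(-n,z) = T(-n+1,z)⁻¹ ⋯ T(0,z)⁻¹` for `n ≥ 0`. -/
def transferNeg (V : ℤ → ℝ) (z : ℂ) : ℕ → Matrix (Fin 2) (Fin 2) ℂ
  | 0 => 1
  | n + 1 => (stepMatrix V z (-(n : ℤ)))⁻¹ * transferNeg V z n

/-- The transfer matrix `Φ(n,z)` for `n ∈ ℤ`. -/
def transfer (V : ℤ → ℝ) (z : ℂ) : ℤ → Matrix (Fin 2) (Fin 2) ℂ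
  | Int.ofNat n => transferPos V z n
  | Int.negSucc n => transferNeg V z (n + 1)

/-- The squared operator norm `‖Φ(n,z)‖²` on `ℂ²` with its Euclidean norm. -/
def transferNormSq (V : ℤ → ℝ) (z : ℂ) (n : ℤ) : ℝ≥0 :=
  ‖Matrix.toEuclideanCLM (n := Fin 2) (𝕜 := ℂ) (transfer V z n)‖₊ ^ 2

/-- `max_{1 ≤ n ≤ L} ‖Φ(n,z)‖²`. -/
def maxRight (V : ℤ → ℝ) (z : ℂ) (L : ℝ) : ℝ≥0 :=
  (Finset.Icc 1 ⌊L⌋₊).sup fun n : ℕ => transferNormSq V z (n : ℤ)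

/-- `max_{1 ≤ -n ≤ L} ‖Φ(n,z)‖²`. -/
def maxLeft (V : ℤ → ℝ) (z : ℂ) (L : ℝ) : ℝ≥0 :=
  (Finset.Icc 1 ⌊L⌋₊).sup fun n : ℕ => transferNormSq V z (-(n : ℤ))

end Schrodinger

end

noncomputable section

namespace Schrodinger

/-! Fourier inversion along the line Im z = 1/t recovers e^{-itH}δ_0 from the Green function u = (z
- H)⁻¹δ_0, at the price of a constant factor e. For energies outside [-K, K] a Combes-Thomas
estimate makes u(n) exponentially small in |n| and integrable in the energy; on [-K, K]
Cauchy-Schwarz reduces the probability of a set S of sites to the energy integral of the mass of u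
in S (`exists_mass_psi_le`).

The tail of u is compared with the transfer matrices by cutting the line after a site N
(`exists_tail_bound`). The Green function w of the cut operator solves the difference equation on
[1, N] with w(N+1) = 0. Since det Φ(N) = 1, w(0) and -w(1) are w(N) times the entries of the first
row of Φ(N), so a large row forces w(N) to be small. Beyond N, u agrees with u - w, the resolvent of
H applied to w(N)δ_{N+1}. Two consecutive cuts control the whole matrix, and a reflection treats the
left half-line.

For a > α the sites beyond t^a - 1 eventually lie beyond Ct^α, so the best cut up to Ct^α may be
used. The hypothesis absorbs the loss t^4, and the outside probability decays faster than every
power of t; hence S⁺(a) = ∞. For the moments, sites below t^a contribute at most t^{ap}, sites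
between t^a and 10t at most (10t)^p times the outside probability, and sites beyond 10t a bounded
amount by the ballistic bound (`exists_moment_le`). -/

/-! ### Lower bounds for z - A and the resolvent -/

theorem inner_self_apply_im {A : L2Z →L[ℂ] L2Z} (hA : IsSelfAdjoint A)
    (u : L2Z) : (inner ℂ u (A u)).im = 0 := by
  have h := (ContinuousLinearMap.isSelfAdjoint_iff_isSymmetric.1 hA) u u
  simp only [ContinuousLinearMap.coe_coe] at h
  have h2 := inner_conj_symm (𝕜 := ℂ) u (A u)
  rw [h] at h2
  exact Complex.conj_eq_iff_im.1 h2

/-- The imaginary part of the spectral parameter bounds `z - A` from below. -/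
theorem im_mul_norm_le {A : L2Z →L[ℂ] L2Z} (hA : IsSelfAdjoint A) (z : ℂ) (u : L2Z) :
    z.im * ‖u‖ ≤ ‖z • u - A u‖ := by
  rcases eq_or_ne u 0 with rfl | hu
  · simp
  have hu' : 0 < ‖u‖ := norm_pos_iff.2 hu
  have h1 : (inner ℂ u (z • u - A u)).im = z.im * ‖u‖ ^ 2 := by
    rw [inner_sub_right, inner_smul_right, inner_self_eq_norm_sq_to_K, Complex.sub_im,
      inner_self_apply_im hA]
    simp [← Complex.ofReal_pow]
  have h2 : z.im * ‖u‖ ^ 2 ≤ ‖u‖ * ‖z • u - A u‖ := by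
    rw [← h1]
    exact ((le_abs_self _).trans (Complex.abs_im_le_norm _)).trans (norm_inner_le_norm _ _)
  nlinarith

/-- Used at energies beyond the norm of A, where it gives a lower bound that does not degenerate as
Im z tends to 0. -/
theorem re_mul_norm_le (A : L2Z →L[ℂ] L2Z) {R : ℝ} (hR : ‖A‖ ≤ R) (z : ℂ) (u : L2Z) :
    (|z.re| - R) * ‖u‖ ≤ ‖z • u - A u‖ := by
  have h1 : ‖A u‖ ≤ R * ‖u‖ := (A.le_opNorm u).trans (by gcongr)
  have h2 : |z.re| * ‖u‖ ≤ ‖z • u‖ := by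
    rw [norm_smul]; gcongr; exact Complex.abs_re_le_norm z
  have h3 := norm_sub_norm_le (z • u) (A u)
  linarith

theorem mem_resolventSet_of_im {A : L2Z →L[ℂ] L2Z} (hA : IsSelfAdjoint A) {z : ℂ}
    (hz : z.im ≠ 0) : z ∈ resolventSet ℂ A := by
  by_contra h
  have h2 := hA.mem_spectrum_eq_re (z := z) h
  rw [h2] at hz
  simp at hz

theorem resolvent_sub {A : L2Z →L[ℂ] L2Z} {z : ℂ} (hz : z ∈ resolventSet ℂ A) (f : L2Z) :
    z • resolvent A z f - A (resolvent A z f) = f := by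
  have h : (algebraMap ℂ (L2Z →L[ℂ] L2Z) z - A) * resolvent A z = 1 :=
    Ring.mul_inverse_cancel _ (spectrum.mem_resolventSet_iff.1 hz)
  have h2 := congrArg (fun B : L2Z →L[ℂ] L2Z => B f) h
  simpa [Algebra.algebraMap_eq_smul_one] using h2

/-! ### Self-adjointness and norm of the Hamiltonian -/

theorem shiftOp_apply (k : ℤ) (u : L2Z) (n : ℤ) : shiftOp k u n = u (n + k) := rfl

theorem potentialOp_apply (V : ℤ → ℝ) (hV : ∃ M : ℝ, ∀ n, |V n| ≤ M) (u : L2Z) (n : ℤ) :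
    potentialOp V hV u n = (V n : ℂ) * u n := rfl

theorem norm_potentialOp_le {V : ℤ → ℝ} (hV : ∃ M : ℝ, ∀ n, |V n| ≤ M) {M : ℝ}
    (hM : ∀ n, |V n| ≤ M) (u : L2Z) : ‖potentialOp V hV u‖ ≤ M * ‖u‖ := by
  have hM0 : 0 ≤ M := (abs_nonneg _).trans (hM 0)
  have h2 : ‖(M : ℂ) • u‖ = M * ‖u‖ := by
    rw [norm_smul, Complex.norm_real, Real.norm_eq_abs, abs_of_nonneg hM0]
  rw [← h2]
  exact lp.norm_mono (by norm_num) fun n => norm_potential_mul_le hM u n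

theorem norm_shiftOp_le (k : ℤ) (u : L2Z) : ‖shiftOp k u‖ ≤ ‖u‖ := by
  have h : ‖shiftOp k‖ ≤ 1 := LinearMap.mkContinuous_norm_le _ zero_le_one _
  simpa using (shiftOp k).le_of_opNorm_le h u

theorem inner_delta (n : ℤ) (u : L2Z) : inner ℂ (delta n) u = u n := by
  rw [delta, lp.inner_single_left]
  simp

theorem delta_apply_self (n : ℤ) : delta n n = 1 := by
  simp [delta]

theorem delta_apply_ne {m n : ℤ} (h : n ≠ m) : delta m n = 0 := by
  simp [delta, h]

theorem norm_delta (n : ℤ) : ‖delta n‖ = 1 := by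
  rw [delta, lp.norm_single (by norm_num)]; simp

theorem inner_shiftOp_left (k : ℤ) (u v : L2Z) :
    inner ℂ (shiftOp k u) v = inner ℂ u (shiftOp (-k) v) := by
  rw [lp.inner_eq_tsum, lp.inner_eq_tsum, ← (Equiv.addRight k).tsum_eq
    (fun n : ℤ => inner ℂ (u n) (shiftOp (-k) v n))]
  simp [shiftOp_apply]

theorem inner_potentialOp_left (V : ℤ → ℝ) (hV : ∃ M : ℝ, ∀ n, |V n| ≤ M) (u v : L2Z) :
    inner ℂ (potentialOp V hV u) v = inner ℂ u (potentialOp V hV v) := by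
  rw [lp.inner_eq_tsum, lp.inner_eq_tsum]
  refine tsum_congr fun n => ?_
  simp only [potentialOp_apply, RCLike.inner_apply, map_mul, Complex.conj_ofReal]
  ring

theorem isSelfAdjoint_potentialOp (V : ℤ → ℝ) (hV : ∃ M : ℝ, ∀ n, |V n| ≤ M) :
    IsSelfAdjoint (potentialOp V hV) :=
  ContinuousLinearMap.isSelfAdjoint_iff_isSymmetric.2 fun u v => inner_potentialOp_left V hV u v

theorem isSelfAdjoint_hamiltonian (V : ℤ → ℝ) (hV : ∃ M : ℝ, ∀ n, |V n| ≤ M) :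
    IsSelfAdjoint (hamiltonian V hV) := by
  refine ContinuousLinearMap.isSelfAdjoint_iff_isSymmetric.2 fun u v => ?_
  simp only [hamiltonian, ContinuousLinearMap.coe_coe, _root_.add_apply,
    inner_add_left, inner_add_right, inner_shiftOp_left, inner_potentialOp_left, neg_neg]
  ring

/-- The norm of a self-adjoint operator is its spectral radius. The location of the spectrum enters
the argument only through this bound. -/
theorem norm_hamiltonian_le (V : ℤ → ℝ) (hV : ∃ M : ℝ, ∀ n, |V n| ≤ M) {K : ℝ} (hK : 1 ≤ K)
    (hspec : spectrum ℂ (hamiltonian V hV) ⊆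
      (fun x : ℝ => (x : ℂ)) '' Set.Icc (-K + 1) (K - 1)) : ‖hamiltonian V hV‖ ≤ K - 1 := by
  have h := (isSelfAdjoint_hamiltonian V hV).spectralRadius_eq_nnnorm
  have h1 : spectralRadius ℂ (hamiltonian V hV) ≤ ((K - 1).toNNReal : ℝ≥0∞) := by
    refine iSup₂_le fun z hz => ?_
    obtain ⟨x, hx, rfl⟩ := hspec hz
    rw [ENNReal.coe_le_coe, ← NNReal.coe_le_coe, Real.coe_toNNReal _ (by linarith), coe_nnnorm]
    simp only [Complex.norm_real, Real.norm_eq_abs]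
    exact abs_le.2 ⟨by linarith [hx.1], hx.2⟩
  rw [h, ENNReal.coe_le_coe, ← NNReal.coe_le_coe, Real.coe_toNNReal _ (by linarith),
    coe_nnnorm] at h1
  exact h1

/-! ### Combes-Thomas estimates -/

/-- The truncated exponential weight `(5/4)^min(|n|, M)`. -/
def weight (M : ℕ) (n : ℤ) : ℝ := (5 / 4) ^ min n.natAbs M

theorem weight_pos (M : ℕ) (n : ℤ) : 0 < weight M n := by unfold weight; positivity

theorem weight_bounded (M : ℕ) : ∃ B : ℝ, ∀ n, |weight M n| ≤ B := by
  refine ⟨(5 / 4) ^ M, fun n => ?_⟩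
  rw [abs_of_pos (weight_pos M n), weight]
  exact pow_le_pow_right₀ (by norm_num) (min_le_right _ _)

/-- Between neighbours min(|n|, M) changes by at most one, so the ratio of weights is 1, 5/4 or 4/5.
-/
theorem abs_one_sub_weight_div_le (M : ℕ) {m n : ℤ} (h : m = n + 1 ∨ m = n - 1) :
    |1 - weight M m / weight M n| ≤ 1 / 4 := by
  have hn := weight_pos M n
  have key : weight M m = weight M n ∨ weight M m = 5 / 4 * weight M n ∨
      weight M n = 5 / 4 * weight M m := by
    have : min m.natAbs M = min n.natAbs M ∨ min m.natAbs M = min n.natAbs M + 1 ∨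
        min n.natAbs M = min m.natAbs M + 1 := by omega
    unfold weight
    rcases this with h | h | h
    · left; rw [h]
    · right; left; rw [h, pow_succ]; ring
    · right; right; rw [h, pow_succ]; ring
  have hm := weight_pos M m
  rcases key with h | h | h
  · rw [h, div_self hn.ne']; norm_num
  · rw [h, mul_div_assoc, div_self hn.ne']; norm_num [abs_of_neg]
  · rw [h, div_mul_eq_div_div_swap, div_self hm.ne']; norm_num [abs_of_pos]

theorem relative_weight_bounded (M : ℕ) (s : ℤ) (hs : s = 1 ∨ s = -1) (n : ℤ) :
    |1 - weight M (n + s) / weight M n| ≤ 1 / 4 :=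
  abs_one_sub_weight_div_le M (by rcases hs with rfl | rfl <;> omega)

/-- The potential commutes with the weight, and each of the two shifts contributes a relative jump
of at most 1/4. The bound is uniform in the truncation M. -/
theorem hamiltonian_weight_commutator (V : ℤ → ℝ) (hV : ∃ M : ℝ, ∀ n, |V n| ≤ M) (M : ℕ)
    (u : L2Z) :
    ‖hamiltonian V hV (potentialOp (weight M) (weight_bounded M) u) -
      potentialOp (weight M) (weight_bounded M) (hamiltonian V hV u)‖ ≤
      1 / 2 * ‖potentialOp (weight M) (weight_bounded M) u‖ := by
  set D := potentialOp (weight M) (weight_bounded M) with hD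
  have hb : ∀ s : ℤ, s = 1 ∨ s = -1 → ∀ n, |1 - weight M (n + s) / weight M n| ≤ 1 / 4 :=
    relative_weight_bounded M
  have heq : hamiltonian V hV (D u) - D (hamiltonian V hV u) =
      shiftOp 1 (potentialOp (fun n => 1 - weight M (n + -1) / weight M n)
        ⟨_, hb (-1) (Or.inr rfl)⟩ (D u)) +
      shiftOp (-1) (potentialOp (fun n => 1 - weight M (n + 1) / weight M n)
        ⟨_, hb 1 (Or.inl rfl)⟩ (D u)) := by
    ext n
    have h1 := (weight_pos M (n + 1)).ne'
    have h2 := (weight_pos M (n + -1)).ne'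
    have h1' : (weight M (n + 1) : ℂ) ≠ 0 := by exact_mod_cast h1
    have h2' : (weight M (n + -1) : ℂ) ≠ 0 := by exact_mod_cast h2
    simp only [lp.coeFn_sub, lp.coeFn_add, Pi.sub_apply, Pi.add_apply, hamiltonian_apply, hD,
      potentialOp_apply, shiftOp_apply, sub_eq_add_neg n 1, add_neg_cancel_right,
      neg_add_cancel_right]
    push_cast
    field_simp
    ring
  rw [heq]
  refine (norm_add_le _ _).trans ?_
  have e1 := (norm_shiftOp_le 1 _).trans
    (norm_potentialOp_le ⟨_, hb (-1) (Or.inr rfl)⟩ (hb (-1) (Or.inr rfl)) (D u))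
  have e2 := (norm_shiftOp_le (-1) _).trans
    (norm_potentialOp_le ⟨_, hb 1 (Or.inl rfl)⟩ (hb 1 (Or.inl rfl)) (D u))
  linarith

/-- Combes-Thomas estimate: away from the spectrum the Green function decays exponentially. -/
theorem combes_thomas (V : ℤ → ℝ) (hV : ∃ M : ℝ, ∀ n, |V n| ≤ M) {z : ℂ} {d : ℝ} (hd : 1 ≤ d)
    (hz : ∀ y, d * ‖y‖ ≤ ‖z • y - hamiltonian V hV y‖) {u : L2Z}
    (hu : z • u - hamiltonian V hV u = delta 0) (n : ℤ) :
    ‖u n‖ ≤ 2 / d * (4 / 5) ^ n.natAbs := by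
  -- Truncating at |n| keeps the weight bounded and still gives its full value at the site n.
  set M := n.natAbs
  set D := potentialOp (weight M) (weight_bounded M) with hD
  have hδ : D (delta 0) = delta 0 := by
    ext m
    rw [hD, potentialOp_apply]
    rcases eq_or_ne m 0 with rfl | hm
    · simp [weight]
    · simp [delta_apply_ne hm]
  have h1 : z • D u - hamiltonian V hV (D u) =
      delta 0 - (hamiltonian V hV (D u) - D (hamiltonian V hV u)) := by
    rw [← hδ, ← hu, map_sub, map_smul]
    abel
  have h2 := hz (D u)
  rw [h1] at h2
  have h3 := (h2.trans (norm_sub_le _ _)).trans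
    (add_le_add_right (hamiltonian_weight_commutator V hV M u) _)
  rw [norm_delta, ← hD] at h3
  -- The commutator is absorbed on the left: d‖Du‖ ≤ 1 + ‖Du‖/2 with d ≥ 1.
  have h4 : ‖D u‖ ≤ 2 / d := by
    rw [le_div_iff₀ (by linarith)]
    nlinarith [norm_nonneg (D u)]
  have h5 : ‖D u n‖ ≤ ‖D u‖ := lp.norm_apply_le_norm (by norm_num) (D u) n
  have h6 : ‖D u n‖ = (5 / 4) ^ M * ‖u n‖ := by
    rw [hD, potentialOp_apply, norm_mul, Complex.norm_real, Real.norm_eq_abs,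
      abs_of_pos (weight_pos _ _), weight, min_self]
  rw [h6] at h5
  have h7 : (4 / 5 : ℝ) ^ M * (5 / 4) ^ M = 1 := by rw [← mul_pow]; norm_num
  calc ‖u n‖ = (4 / 5) ^ M * ((5 / 4) ^ M * ‖u n‖) := by rw [← mul_assoc, h7, one_mul]
    _ ≤ (4 / 5) ^ M * (2 / d) := by gcongr; exact h5.trans h4
    _ = _ := mul_comm _ _

/-- Exponential decay with one extra power of `|z|`, off the diagonal. -/
theorem combes_thomas_off_diagonal {V : ℤ → ℝ} (hV : ∃ M : ℝ, ∀ n, |V n| ≤ M) {B : ℝ}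
    (hB : ∀ n, |V n| ≤ B) {z : ℂ} {d : ℝ} (hd : 1 ≤ d)
    (hz : ∀ y, d * ‖y‖ ≤ ‖z • y - hamiltonian V hV y‖) {u : L2Z}
    (hu : z • u - hamiltonian V hV u = delta 0) {n : ℤ} (hn : n ≠ 0) :
    ‖z‖ * ‖u n‖ ≤ 2 / d * (3 + B) * (4 / 5) ^ n.natAbs := by
  have hct := combes_thomas V hV hd hz hu
  -- Off the origin the equation has no source, so z u(n) is a combination of three values that
  -- already decay. The factor |z| gained here makes the Green function integrable at large
  -- energies.
  have h1 : z * u n = u (n + 1) + u (n - 1) + (V n : ℂ) * u n := by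
    have := congrArg (fun w : L2Z => w n) hu
    simp only [lp.coeFn_sub, lp.coeFn_smul, Pi.sub_apply, Pi.smul_apply, smul_eq_mul,
      hamiltonian_apply, delta_apply_ne hn] at this
    linear_combination this
  have hd' : 0 ≤ 2 / d := by positivity
  have hq : ∀ k : ℕ, n.natAbs ≤ k + 1 → (4 / 5 : ℝ) ^ k ≤ 5 / 4 * (4 / 5) ^ n.natAbs := by
    intro k hk
    have := pow_le_pow_of_le_one (show (0 : ℝ) ≤ 4 / 5 by norm_num) (by norm_num) hk
    rw [pow_succ] at this
    linarith
  have e1 : ‖u (n + 1)‖ ≤ 2 / d * (5 / 4 * (4 / 5) ^ n.natAbs) :=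
    (hct _).trans (mul_le_mul_of_nonneg_left (hq _ (by omega)) hd')
  have e2 : ‖u (n - 1)‖ ≤ 2 / d * (5 / 4 * (4 / 5) ^ n.natAbs) :=
    (hct _).trans (mul_le_mul_of_nonneg_left (hq _ (by omega)) hd')
  have e3 : ‖(V n : ℂ) * u n‖ ≤ B * (2 / d * (4 / 5) ^ n.natAbs) := by
    rw [norm_mul, Complex.norm_real, Real.norm_eq_abs]
    exact mul_le_mul (hB n) (hct n) (norm_nonneg _) ((abs_nonneg _).trans (hB n))
  rw [← norm_mul, h1]
  have h0 : 0 ≤ 2 / d * (4 / 5) ^ n.natAbs := by positivity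
  calc _ ≤ ‖u (n + 1)‖ + ‖u (n - 1)‖ + ‖(V n : ℂ) * u n‖ := norm_add₃_le
    _ ≤ _ := by linarith

/-! ### Transfer matrices and the right tail of the Green function -/

/-- The mass `∑_{n ∈ S} |u(n)|²`. -/
def mass (u : ℤ → ℂ) (S : Set ℤ) : ℝ≥0∞ := ∑' n : S, ‖u n‖ₑ ^ 2

theorem mass_mono (u : ℤ → ℂ) {S T : Set ℤ} (h : S ⊆ T) : mass u S ≤ mass u T :=
  ENNReal.tsum_mono_subtype (fun n => ‖u n‖ₑ ^ 2) h

theorem mass_congr {u v : ℤ → ℂ} {S : Set ℤ} (h : ∀ n ∈ S, u n = v n) : mass u S = mass v S :=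
  tsum_congr fun n => by rw [h n n.2]

theorem enorm_sq_eq_ofReal (x : ℂ) : ‖x‖ₑ ^ 2 = ENNReal.ofReal (‖x‖ ^ 2) := by
  rw [ENNReal.ofReal_pow (norm_nonneg _), ofReal_norm]

theorem tsum_enorm_sq (u : L2Z) : ∑' n, ‖u n‖ₑ ^ 2 = ENNReal.ofReal (‖u‖ ^ 2) := by
  have h : HasSum (fun n => ‖u n‖ ^ 2) (‖u‖ ^ 2) := by
    have := lp.hasSum_norm (p := 2) (by norm_num) u
    simpa using this
  simp_rw [enorm_sq_eq_ofReal]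
  rw [← h.tsum_eq, ENNReal.ofReal_tsum_of_nonneg (fun n => by positivity) h.summable]

theorem mass_le (u : L2Z) (S : Set ℤ) : mass u S ≤ ENNReal.ofReal (‖u‖ ^ 2) := by
  rw [← tsum_enorm_sq]
  exact ENNReal.tsum_comp_le_tsum_of_injective Subtype.val_injective _

/-- Restriction to the half-line `n ≤ N`, seen as a multiplication operator. -/
def cutoff (N n : ℤ) : ℝ := if n ≤ N then 1 else 0

theorem cutoff_le (N n : ℤ) : |cutoff N n| ≤ 1 := by
  unfold cutoff; split_ifs <;> simp

/-- A solution of the difference equation on `[1, N]` is propagated by the transfer matrices. -/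
theorem transferPos_propagates {V : ℤ → ℝ} {z : ℂ} {w : ℤ → ℂ} {N : ℕ}
    (hw : ∀ n : ℤ, 1 ≤ n → n ≤ N → w (n + 1) = (z - V n) * w n - w (n - 1)) :
    ∀ n : ℕ, n ≤ N →
      w (n + 1) = transferPos V z n 0 0 * w 1 + transferPos V z n 0 1 * w 0 ∧
      w n = transferPos V z n 1 0 * w 1 + transferPos V z n 1 1 * w 0 := by
  intro n
  induction n with
  | zero => intro _; simp [transferPos]
  | succ n ih =>
    intro hn
    obtain ⟨h1, h2⟩ := ih (by omega)
    have h3 := hw (n + 1) (by omega) (by exact_mod_cast hn)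
    rw [add_sub_cancel_right, h1, h2] at h3
    have hc : ((n + 1 : ℕ) : ℤ) = (n : ℤ) + 1 := by push_cast; ring
    rw [hc, h3, h1]
    simp only [transferPos, stepMatrix, Matrix.mul_apply, Fin.sum_univ_two, Matrix.of_apply,
      Matrix.cons_val', Matrix.cons_val_zero, Matrix.cons_val_one, Matrix.cons_val_fin_one]
    constructor <;> ring

theorem det_transferPos (V : ℤ → ℝ) (z : ℂ) (n : ℕ) :
    transferPos V z n 0 0 * transferPos V z n 1 1 -
      transferPos V z n 0 1 * transferPos V z n 1 0 = 1 := by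
  induction n with
  | zero => simp [transferPos]
  | succ n ih =>
    simp only [transferPos, stepMatrix, Matrix.mul_apply, Fin.sum_univ_two, Matrix.of_apply,
      Matrix.cons_val', Matrix.cons_val_zero, Matrix.cons_val_one, Matrix.cons_val_fin_one]
    linear_combination ih

theorem norm_sq_add_norm_sq_le (w : L2Z) {m n : ℤ} (h : m ≠ n) :
    ‖w m‖ ^ 2 + ‖w n‖ ^ 2 ≤ ‖w‖ ^ 2 := by
  have := lp.sum_rpow_le_norm_rpow (p := 2) (by norm_num) w {m, n}
  rw [Finset.sum_pair h] at this
  simpa using this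

/-- Cutting the line to the right of `N` bounds the part of the Green function beyond `N` by the
first row of the transfer matrix. -/
theorem exists_tail_bound (V : ℤ → ℝ) (hV : ∃ M : ℝ, ∀ n, |V n| ≤ M) {z : ℂ} (hz : 0 < z.im)
    {u : L2Z} (hu : z • u - hamiltonian V hV u = delta 0) (N : ℕ) :
    ∃ v : L2Z, (∀ n : ℤ, (N : ℤ) < n → v n = u n) ∧
      ‖v‖ ^ 2 * (‖transferPos V z N 0 0‖ ^ 2 + ‖transferPos V z N 0 1‖ ^ 2) ≤ z.im⁻¹ ^ 4 := by
  set H := hamiltonian V hV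
  have hHs : IsSelfAdjoint H := isSelfAdjoint_hamiltonian V hV
  set P := potentialOp (cutoff N) ⟨1, cutoff_le N⟩ with hP
  have hPs : IsSelfAdjoint P := isSelfAdjoint_potentialOp _ _
  -- The compression acts on the whole space, so the resolvent bound applies to it. Beyond N it
  -- vanishes, and z ≠ 0 then forces w = 0 there.
  have hA : IsSelfAdjoint (P * H * P) := by
    have h := hHs.conjugate P
    rwa [hPs.star_eq] at h
  obtain ⟨w, hw⟩ : ∃ w, z • w - (P * H * P) w = delta 0 :=
    ⟨_, resolvent_sub (mem_resolventSet_of_im hA hz.ne') _⟩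
  have hz0 : z ≠ 0 := by rintro rfl; simp at hz
  have hPa : ∀ (y : L2Z) (n : ℤ), P y n = (cutoff N n : ℂ) * y n := fun y n => rfl
  have hwn : ∀ n : ℤ, z * w n - cutoff N n * H (P w) n = delta 0 n := fun n =>
    congrArg (fun y : L2Z => y n) hw
  have hw0 : ∀ n : ℤ, (N : ℤ) < n → w n = 0 := fun n hn => by
    have := hwn n
    rw [delta_apply_ne (by omega), cutoff, if_neg (by omega)] at this
    simpa [hz0] using this
  have hPw : P w = w := by
    ext n
    rw [hPa, cutoff]
    split_ifs with h
    · simp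
    · rw [hw0 n (by omega)]; simp
  rw [hPw] at hwn
  have hwnorm : ‖w‖ ≤ z.im⁻¹ := by
    have := im_mul_norm_le hA z w
    rw [hw, norm_delta] at this
    rw [← one_div, le_div_iff₀ hz]; linarith
  -- Cutting removes only the hopping from N to N + 1, which leaves one source term at N + 1.
  have hHw : z • w - H w = delta 0 - w N • delta ((N : ℤ) + 1) := by
    ext n
    simp only [lp.coeFn_sub, lp.coeFn_smul, Pi.sub_apply, Pi.smul_apply, smul_eq_mul]
    rcases le_or_gt n N with h | h
    · have := hwn n
      rw [cutoff, if_pos h] at this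
      rw [delta_apply_ne (show n ≠ (N : ℤ) + 1 by omega), ← this]; simp
    · rw [delta_apply_ne (show n ≠ 0 by omega), hw0 n h, hamiltonian_apply,
        hw0 (n + 1) (by omega), hw0 n h]
      rcases eq_or_ne n (N + 1) with rfl | hne
      · rw [delta_apply_self]; simp
      · rw [delta_apply_ne hne, hw0 (n - 1) (by omega)]; simp
  refine ⟨u - w, fun n hn => by simp [hw0 n hn], ?_⟩
  have huw : ‖u - w‖ ≤ z.im⁻¹ * ‖w N‖ := by
    have h1 := im_mul_norm_le hHs z (u - w)
    have h2 : z • (u - w) - H (u - w) = w N • delta ((N : ℤ) + 1) := by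
      have : z • (u - w) - H (u - w) = (z • u - H u) - (z • w - H w) := by
        rw [smul_sub, map_sub]; abel
      rw [this, hu, hHw]; abel
    rw [h2, norm_smul, norm_delta, mul_one] at h1
    rw [inv_mul_eq_div, le_div_iff₀ hz]; linarith
  have hprop := transferPos_propagates (V := V) (z := z) (w := w) (N := N) (fun n h1 h2 => by
    have := hwn n
    rw [cutoff, if_pos h2, delta_apply_ne (show n ≠ 0 by omega), hamiltonian_apply] at this
    push_cast at this
    linear_combination -this) N le_rfl
  rw [hw0 (N + 1) (by omega)] at hprop
  obtain ⟨h1, h2⟩ := hprop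
  have hdet := det_transferPos V z N
  set a := transferPos V z N 0 0
  set b := transferPos V z N 0 1
  -- Solving the propagation backwards by Cramer's rule, with determinant 1 and w(N+1) = 0.
  have e1 : a * w N = w 0 := by
    rw [h2]; linear_combination w 0 * hdet - transferPos V z N 1 0 * h1
  have e2 : b * w N = - w 1 := by
    rw [h2]; linear_combination - w 1 * hdet - transferPos V z N 1 1 * h1
  have e3 : ‖w N‖ ^ 2 * (‖a‖ ^ 2 + ‖b‖ ^ 2) = ‖w 0‖ ^ 2 + ‖w 1‖ ^ 2 := by
    rw [← e1, ← norm_neg (w 1), ← e2, norm_mul, norm_mul]; ring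
  have hi : 0 < z.im⁻¹ := inv_pos.2 hz
  calc _ ≤ (z.im⁻¹ * ‖w N‖) ^ 2 * (‖a‖ ^ 2 + ‖b‖ ^ 2) := by gcongr
    _ = z.im⁻¹ ^ 2 * (‖w 0‖ ^ 2 + ‖w 1‖ ^ 2) := by rw [← e3]; ring
    _ ≤ z.im⁻¹ ^ 2 * z.im⁻¹ ^ 2 := by
      gcongr
      exact (norm_sq_add_norm_sq_le w (by norm_num)).trans (by gcongr)
    _ = _ := by ring

/-- The operator norm of a `2 × 2` matrix is at most its Frobenius norm. -/
theorem norm_toEuclideanCLM_sq_le (A : Matrix (Fin 2) (Fin 2) ℂ) :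
    ‖Matrix.toEuclideanCLM (n := Fin 2) (𝕜 := ℂ) A‖ ^ 2 ≤
      ‖A 0 0‖ ^ 2 + ‖A 0 1‖ ^ 2 + (‖A 1 0‖ ^ 2 + ‖A 1 1‖ ^ 2) := by
  set F := ‖A 0 0‖ ^ 2 + ‖A 0 1‖ ^ 2 + (‖A 1 0‖ ^ 2 + ‖A 1 1‖ ^ 2) with hF
  have hF0 : 0 ≤ F := by positivity
  have hrow : ∀ a b x y : ℂ, ‖a * x + b * y‖ ^ 2 ≤
      (‖a‖ ^ 2 + ‖b‖ ^ 2) * (‖x‖ ^ 2 + ‖y‖ ^ 2) := fun a b x y => by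
    have h1 : ‖a * x + b * y‖ ≤ ‖a‖ * ‖x‖ + ‖b‖ * ‖y‖ := by
      simpa only [norm_mul] using norm_add_le (a * x) (b * y)
    have h2 : ‖a * x + b * y‖ ^ 2 ≤ (‖a‖ * ‖x‖ + ‖b‖ * ‖y‖) ^ 2 := by gcongr
    nlinarith [sq_nonneg (‖a‖ * ‖y‖ - ‖b‖ * ‖x‖)]
  have h : ‖Matrix.toEuclideanCLM (n := Fin 2) (𝕜 := ℂ) A‖ ≤ √F := by
    refine ContinuousLinearMap.opNorm_le_bound _ (Real.sqrt_nonneg _) fun x => ?_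
    refine le_of_sq_le_sq ?_ (by positivity)
    rw [mul_pow, Real.sq_sqrt hF0, EuclideanSpace.norm_sq_eq, EuclideanSpace.norm_sq_eq]
    simp only [Fin.sum_univ_two, Matrix.ofLp_toEuclideanCLM, Matrix.mulVec, dotProduct]
    nlinarith [hrow (A 0 0) (A 0 1) (x 0) (x 1), hrow (A 1 0) (A 1 1) (x 0) (x 1)]
  calc _ ≤ √F ^ 2 := by gcongr
    _ = F := Real.sq_sqrt hF0

theorem mass_mul_row_le (V : ℤ → ℝ) (hV : ∃ M : ℝ, ∀ n, |V n| ≤ M) {z : ℂ} (hz : 0 < z.im)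
    {u : L2Z} (hu : z • u - hamiltonian V hV u = delta 0) (N : ℕ) :
    mass u {n | (N : ℤ) < n} *
      ENNReal.ofReal (‖transferPos V z N 0 0‖ ^ 2 + ‖transferPos V z N 0 1‖ ^ 2) ≤
      ENNReal.ofReal (z.im⁻¹ ^ 4) := by
  obtain ⟨v, h1, h2⟩ := exists_tail_bound V hV hz hu N
  have hm : mass u {n | (N : ℤ) < n} = mass v {n | (N : ℤ) < n} :=
    mass_congr fun n hn => (h1 n hn).symm
  rw [hm]
  refine (mul_le_mul_left (mass_le v _) _).trans ?_
  rw [← ENNReal.ofReal_mul (by positivity)]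
  exact ENNReal.ofReal_le_ofReal h2

theorem coe_transferNormSq (V : ℤ → ℝ) (z : ℂ) (n : ℤ) :
    (transferNormSq V z n : ℝ≥0∞) =
      ENNReal.ofReal (‖Matrix.toEuclideanCLM (n := Fin 2) (𝕜 := ℂ) (transfer V z n)‖ ^ 2) := by
  rw [ENNReal.ofReal, ENNReal.coe_inj, transferNormSq, Real.toNNReal_pow (norm_nonneg _),
    norm_toNNReal]

/-- The second row of Φ(N) is the first row of Φ(N-1), so cuts at N and N - 1 together bound the
Frobenius norm. For N = 0 the second row is (0, 1) and the resolvent bound suffices; there Im z ≤ 1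
raises the power of 1/Im z from 2 to 4. -/
theorem mass_mul_transferNormSq_le (V : ℤ → ℝ) (hV : ∃ M : ℝ, ∀ n, |V n| ≤ M) {z : ℂ}
    (hz : 0 < z.im) (hz1 : z.im ≤ 1)
    {u : L2Z} (hu : z • u - hamiltonian V hV u = delta 0) (N : ℕ) :
    mass u {n | (N : ℤ) < n} * transferNormSq V z N ≤ ENNReal.ofReal (2 * z.im⁻¹ ^ 4) := by
  have hsecond : mass u {n | (N : ℤ) < n} *
      ENNReal.ofReal (‖transferPos V z N 1 0‖ ^ 2 + ‖transferPos V z N 1 1‖ ^ 2) ≤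
      ENNReal.ofReal (z.im⁻¹ ^ 4) := by
    cases N with
    | zero =>
      simp only [transferPos, Matrix.one_apply_eq, Matrix.one_apply_ne (one_ne_zero (α := Fin 2)),
        norm_zero, norm_one, one_pow]
      norm_num
      refine (mass_le u _).trans (ENNReal.ofReal_le_ofReal ?_)
      have h1 := im_mul_norm_le (isSelfAdjoint_hamiltonian V hV) z u
      rw [hu, norm_delta] at h1
      have h2 : ‖u‖ ≤ z.im⁻¹ := by rw [← one_div, le_div_iff₀ hz]; linarith
      have h3 : 1 ≤ z.im⁻¹ := (one_le_inv₀ hz).2 hz1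
      rw [← inv_pow]
      calc ‖u‖ ^ 2 ≤ z.im⁻¹ ^ 2 := by gcongr
        _ ≤ z.im⁻¹ ^ 4 := pow_le_pow_right₀ h3 (by norm_num)
    | succ N =>
      have e : ∀ j, transferPos V z (N + 1) 1 j = transferPos V z N 0 j := fun j => by
        simp [transferPos, stepMatrix, Matrix.mul_apply, Fin.sum_univ_two]
      rw [e, e]
      refine le_trans ?_ (mass_mul_row_le V hV hz hu N)
      gcongr
      refine mass_mono u fun n hn => ?_
      simp only [Set.mem_ofPred_eq] at hn ⊢
      push_cast at hn
      omega
  have hfirst := mass_mul_row_le V hV hz hu N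
  rw [coe_transferNormSq]
  have hF : ENNReal.ofReal (‖Matrix.toEuclideanCLM (n := Fin 2) (𝕜 := ℂ)
      (transfer V z (N : ℤ))‖ ^ 2) ≤
      ENNReal.ofReal (‖transferPos V z N 0 0‖ ^ 2 + ‖transferPos V z N 0 1‖ ^ 2) +
      ENNReal.ofReal (‖transferPos V z N 1 0‖ ^ 2 + ‖transferPos V z N 1 1‖ ^ 2) := by
    rw [← ENNReal.ofReal_add (by positivity) (by positivity)]
    exact ENNReal.ofReal_le_ofReal (norm_toEuclideanCLM_sq_le (transferPos V z N))
  refine (mul_le_mul_right hF _).trans ?_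
  rw [mul_add, two_mul, ENNReal.ofReal_add (p := z.im⁻¹ ^ 4) (by positivity) (by positivity)]
  exact add_le_add hfirst hsecond

/-! ### The left tail by reflection -/

/-- The reflection `n ↦ u(-n)`. -/
def reflect (u : L2Z) : L2Z :=
  ⟨fun n : ℤ => u (-n), by
    have h := (memℓp_gen_iff (by norm_num)).1 (lp.memℓp u)
    exact (memℓp_gen_iff (by norm_num)).2 (h.comp_injective neg_injective)⟩

theorem reflect_green {V : ℤ → ℝ} (hV : ∃ M : ℝ, ∀ n, |V n| ≤ M)
    (hV' : ∃ M : ℝ, ∀ n, |V (-n)| ≤ M) {z : ℂ} {u : L2Z}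
    (hu : z • u - hamiltonian V hV u = delta 0) :
    z • reflect u - hamiltonian (fun n => V (-n)) hV' (reflect u) = delta 0 := by
  ext n
  have h := congrArg (fun w : L2Z => w (-n)) hu
  have hd : delta 0 (-n) = delta 0 n := by
    rcases eq_or_ne n 0 with rfl | hn
    · simp
    · rw [delta_apply_ne hn, delta_apply_ne (neg_ne_zero.2 hn)]
  rw [← hd, ← h]
  change z * u (-n) - (u (-(n + 1)) + u (-(n - 1)) + (V (-n) : ℂ) * u (-n)) =
    z * u (-n) - (u (-n + 1) + u (-n - 1) + (V (-n) : ℂ) * u (-n))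
  rw [show -(n + 1) = -n - 1 by ring, show -(n - 1) = -n + 1 by ring]
  ring

/-- The matrix exchanging the two coordinates. -/
def swapMatrix : Matrix (Fin 2) (Fin 2) ℂ := !![0, 1; 1, 0]

theorem swapMatrix_mul_self : swapMatrix * swapMatrix = 1 := by
  simp [swapMatrix, Matrix.one_fin_two]

/-- Reversing the direction of propagation exchanges the two components of the state. -/
theorem stepMatrix_inv (V : ℤ → ℝ) (z : ℂ) (m : ℤ) :
    (stepMatrix V z m)⁻¹ = swapMatrix * stepMatrix V z m * swapMatrix := by
  refine Matrix.inv_eq_right_inv ?_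
  simp [swapMatrix, stepMatrix, Matrix.one_fin_two]

/-- The inner swaps cancel in the product of the conjugated inverses. The left product starts at
site 0 and the reflected one at site 1, hence the extra factor T(0). -/
theorem transferNeg_succ_eq (V : ℤ → ℝ) (z : ℂ) (n : ℕ) :
    transferNeg V z (n + 1) = swapMatrix *
      (transferPos (fun m => V (-m)) z n * stepMatrix V z 0) * swapMatrix := by
  induction n with
  | zero => simp [transferNeg, transferPos, stepMatrix_inv]
  | succ n ih =>
    have hs : stepMatrix (fun m => V (-m)) z ((n : ℤ) + 1) =
        stepMatrix V z (-((n + 1 : ℕ) : ℤ)) := by simp [stepMatrix]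
    rw [transferNeg, ih, stepMatrix_inv, transferPos, hs]
    simp only [Matrix.mul_assoc]
    rw [← Matrix.mul_assoc swapMatrix swapMatrix, swapMatrix_mul_self, Matrix.one_mul]

theorem transfer_neg_natCast_succ (V : ℤ → ℝ) (z : ℂ) (n : ℕ) :
    transfer V z (-((n + 1 : ℕ) : ℤ)) = transferNeg V z (n + 1) := rfl

theorem norm_swapMatrix_sq_le :
    ‖Matrix.toEuclideanCLM (n := Fin 2) (𝕜 := ℂ) swapMatrix‖ ^ 2 ≤ 2 := by
  refine (norm_toEuclideanCLM_sq_le _).trans ?_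
  norm_num [swapMatrix]

theorem norm_transferNeg_sq_le (V : ℤ → ℝ) (z : ℂ) (n : ℕ) :
    ‖Matrix.toEuclideanCLM (n := Fin 2) (𝕜 := ℂ) (transferNeg V z (n + 1))‖ ^ 2 ≤
      4 * (‖z - V 0‖ ^ 2 + 2) * ‖Matrix.toEuclideanCLM (n := Fin 2) (𝕜 := ℂ)
        (transferPos (fun m => V (-m)) z n)‖ ^ 2 := by
  rw [transferNeg_succ_eq, map_mul, map_mul, map_mul]
  set J := Matrix.toEuclideanCLM (n := Fin 2) (𝕜 := ℂ) swapMatrix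
  set A := Matrix.toEuclideanCLM (n := Fin 2) (𝕜 := ℂ) (transferPos (fun m => V (-m)) z n)
  set T := Matrix.toEuclideanCLM (n := Fin 2) (𝕜 := ℂ) (stepMatrix V z 0)
  have hJ : ‖J‖ ^ 2 ≤ 2 := norm_swapMatrix_sq_le
  have hT : ‖T‖ ^ 2 ≤ ‖z - V 0‖ ^ 2 + 2 := by
    refine (norm_toEuclideanCLM_sq_le _).trans (le_of_eq ?_)
    simp [stepMatrix]; ring
  have h : ‖J * (A * T) * J‖ ≤ ‖J‖ * (‖A‖ * ‖T‖) * ‖J‖ :=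
    norm_mul₃_le.trans (by gcongr; exact norm_mul_le _ _)
  calc ‖J * (A * T) * J‖ ^ 2 ≤ (‖J‖ * (‖A‖ * ‖T‖) * ‖J‖) ^ 2 := by gcongr
    _ = ‖J‖ ^ 2 * ‖J‖ ^ 2 * ‖T‖ ^ 2 * ‖A‖ ^ 2 := by ring
    _ ≤ 2 * 2 * (‖z - V 0‖ ^ 2 + 2) * ‖A‖ ^ 2 := by gcongr
    _ = _ := by ring

open scoped Pointwise in
theorem mass_reflect (u : L2Z) (S : Set ℤ) : mass (reflect u) S = mass u (-S) := by
  let e : S ≃ (-S : Set ℤ) := (Equiv.neg ℤ).subtypeEquiv fun n => by simp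
  exact e.tsum_eq fun n : (-S : Set ℤ) => ‖u n‖ₑ ^ 2

theorem mass_mul_maxRight_le (V : ℤ → ℝ) (hV : ∃ M : ℝ, ∀ n, |V n| ≤ M) {z : ℂ}
    (hz : 0 < z.im) (hz1 : z.im ≤ 1) {u : L2Z} (hu : z • u - hamiltonian V hV u = delta 0)
    {L : ℝ} {S : Set ℤ} (hS : ∀ n ∈ S, L < (n : ℝ)) :
    mass u S * maxRight V z L ≤ ENNReal.ofReal (2 * z.im⁻¹ ^ 4) := by
  -- For L < 1 the index set is empty and its supremum is 0; otherwise the maximum is attained at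
  -- some N ≤ L, and S lies beyond N.
  rcases (Finset.Icc 1 ⌊L⌋₊).eq_empty_or_nonempty with h | h
  · simp [maxRight, h]
  obtain ⟨N, hN, hmax⟩ := Finset.exists_mem_eq_sup _ h fun n : ℕ => transferNormSq V z (n : ℤ)
  rw [maxRight, hmax]
  refine le_trans ?_ (mass_mul_transferNormSq_le V hV hz hz1 hu N)
  gcongr
  refine mass_mono u fun n hn => ?_
  have h1 := hS n hn
  have hN2 := (Finset.mem_Icc.1 hN)
  have h2 : (N : ℝ) ≤ L := (Nat.le_floor_iff' (by omega)).1 hN2.2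
  have h3 : (N : ℝ) < (n : ℝ) := h2.trans_lt h1
  exact_mod_cast h3

theorem mass_mul_maxLeft_le (V : ℤ → ℝ) (hV : ∃ M : ℝ, ∀ n, |V n| ≤ M) {z : ℂ}
    (hz : 0 < z.im) (hz1 : z.im ≤ 1) {u : L2Z} (hu : z • u - hamiltonian V hV u = delta 0)
    {L : ℝ} {S : Set ℤ} (hS : ∀ n ∈ S, (n : ℝ) < -L) :
    mass u S * maxLeft V z L ≤
      ENNReal.ofReal (4 * (‖z - V 0‖ ^ 2 + 2) * (2 * z.im⁻¹ ^ 4)) := by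
  rcases (Finset.Icc 1 ⌊L⌋₊).eq_empty_or_nonempty with h | h
  · simp [maxLeft, h]
  obtain ⟨N, hN, hmax⟩ := Finset.exists_mem_eq_sup _ h
    fun n : ℕ => transferNormSq V z (-(n : ℤ))
  rw [maxLeft, hmax]
  have hN2 := (Finset.mem_Icc.1 hN)
  have h2 : (N : ℝ) ≤ L := (Nat.le_floor_iff' (by omega)).1 hN2.2
  obtain ⟨n, rfl⟩ : ∃ n, N = n + 1 := ⟨N - 1, by omega⟩
  have hV' : ∃ M : ℝ, ∀ n, |V (-n)| ≤ M := hV.imp fun M hM n => hM _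
  -- The cut is made at n, not n + 1, because Φ(-(n+1)) contains only n reflected factors besides
  -- T(0).
  have hm := mass_mul_transferNormSq_le _ hV' hz hz1 (reflect_green hV hV' hu) n
  have hmass : mass u S ≤ mass (reflect u) {m | (n : ℤ) < m} := by
    rw [mass_reflect]
    refine mass_mono u fun m hm => ?_
    have h1 := hS m hm
    have h3 : (m : ℝ) < -((n + 1 : ℕ) : ℝ) := by linarith
    have h4 : m < -((n + 1 : ℕ) : ℤ) := by exact_mod_cast h3
    simp only [Set.mem_neg, Set.mem_ofPred_eq]
    push_cast at h4
    omega
  have hΦ : (transferNormSq V z (-((n + 1 : ℕ) : ℤ)) : ℝ≥0∞) ≤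
      ENNReal.ofReal (4 * (‖z - V 0‖ ^ 2 + 2)) * transferNormSq (fun m => V (-m)) z n := by
    rw [coe_transferNormSq, coe_transferNormSq, ← ENNReal.ofReal_mul (by positivity)]
    exact ENNReal.ofReal_le_ofReal (norm_transferNeg_sq_le V z n)
  calc _ ≤ mass (reflect u) {m | (n : ℤ) < m} * (ENNReal.ofReal (4 * (‖z - V 0‖ ^ 2 + 2)) *
        transferNormSq (fun m => V (-m)) z n) := mul_le_mul' hmass hΦ
    _ = ENNReal.ofReal (4 * (‖z - V 0‖ ^ 2 + 2)) * (mass (reflect u) {m | (n : ℤ) < m} *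
        transferNormSq (fun m => V (-m)) z n) := by ring
    _ ≤ _ := by
      rw [ENNReal.ofReal_mul (p := 4 * (‖z - V 0‖ ^ 2 + 2)) (by positivity)]
      exact mul_le_mul_right hm _


/-! ### The evolution as a Fourier integral of the Green function -/

theorem hasDerivAt_psi (V : ℤ → ℝ) (hV : ∃ M : ℝ, ∀ n, |V n| ≤ M) (t : ℝ) :
    HasDerivAt (psi V hV) (-Complex.I • hamiltonian V hV (psi V hV t)) t := by
  have h1 : HasDerivAt (fun s : ℂ => NormedSpace.exp (s • hamiltonian V hV))
      (hamiltonian V hV * NormedSpace.exp ((-(Complex.I * (t : ℂ))) • hamiltonian V hV))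
      (-(Complex.I * (t : ℂ))) :=
    hasDerivAt_exp_smul_const' (𝕂 := ℂ) (hamiltonian V hV) _
  have h2 : HasDerivAt (fun s : ℝ => -(Complex.I * (s : ℂ))) (-Complex.I) t := by
    simpa using! ((hasDerivAt_id t).ofReal_comp.const_mul Complex.I).neg
  have h3 := h1.scomp t h2
  exact ((ContinuousLinearMap.apply ℂ L2Z (delta 0)).restrictScalars ℝ).hasFDerivAt.comp_hasDerivAt
    t h3

theorem continuous_psi (V : ℤ → ℝ) (hV : ∃ M : ℝ, ∀ n, |V n| ≤ M) : Continuous (psi V hV) :=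
  continuous_iff_continuousAt.2 fun t => (hasDerivAt_psi V hV t).continuousAt

theorem psi_zero (V : ℤ → ℝ) (hV : ∃ M : ℝ, ∀ n, |V n| ≤ M) : psi V hV 0 = delta 0 := by
  simp [psi]

theorem norm_psi (V : ℤ → ℝ) (hV : ∃ M : ℝ, ∀ n, |V n| ≤ M) (t : ℝ) : ‖psi V hV t‖ = 1 := by
  have ha : IsSelfAdjoint ((-(t : ℂ)) • hamiltonian V hV) := by
    refine IsSelfAdjoint.smul ?_ (isSelfAdjoint_hamiltonian V hV)
    simp [isSelfAdjoint_iff]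
  have hU := (selfAdjoint.expUnitary (A := L2Z →L[ℂ] L2Z) ⟨_, ha⟩).2
  have he : ((selfAdjoint.expUnitary ⟨_, ha⟩ : unitary (L2Z →L[ℂ] L2Z)) : L2Z →L[ℂ] L2Z) =
      NormedSpace.exp ((-(Complex.I * (t : ℂ))) • hamiltonian V hV) := by
    rw [selfAdjoint.expUnitary_coe, smul_smul, mul_neg]
  rw [psi, ← he, ContinuousLinearMap.norm_map_of_mem_unitary hU, norm_delta]

/-- The Green function `(z - H)⁻¹ δ_0`. -/
def green (V : ℤ → ℝ) (hV : ∃ M : ℝ, ∀ n, |V n| ≤ M) (z : ℂ) : L2Z :=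
  resolvent (hamiltonian V hV) z (delta 0)

theorem green_eq (V : ℤ → ℝ) (hV : ∃ M : ℝ, ∀ n, |V n| ≤ M) {z : ℂ} (hz : 0 < z.im) :
    z • green V hV z - hamiltonian V hV (green V hV z) = delta 0 :=
  resolvent_sub (mem_resolventSet_of_im (isSelfAdjoint_hamiltonian V hV) hz.ne') _

theorem continuous_green (V : ℤ → ℝ) (hV : ∃ M : ℝ, ∀ n, |V n| ≤ M) {ε : ℝ} (hε : 0 < ε) :
    Continuous fun E : ℝ => green V hV ((E : ℂ) + Complex.I * (ε : ℂ)) := by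
  refine continuous_iff_continuousAt.2 fun E => ?_
  have hm : (E : ℂ) + Complex.I * (ε : ℂ) ∈ resolventSet ℂ (hamiltonian V hV) :=
    mem_resolventSet_of_im (isSelfAdjoint_hamiltonian V hV) (by simp [hε.ne'])
  have h1 := (spectrum.hasDerivAt_resolvent_const_left hm).continuousAt
  have h2 : ContinuousAt (fun E : ℝ => (E : ℂ) + Complex.I * (ε : ℂ)) E := by fun_prop
  have h3 := ContinuousAt.comp (x := E) (f := fun E : ℝ => (E : ℂ) + Complex.I * (ε : ℂ)) h1 h2
  exact h3.clm_apply continuousAt_const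

theorem continuous_green_apply (V : ℤ → ℝ) (hV : ∃ M : ℝ, ∀ n, |V n| ≤ M) {ε : ℝ} (hε : 0 < ε)
    (n : ℤ) : Continuous fun E : ℝ => green V hV ((E : ℂ) + Complex.I * (ε : ℂ)) n := by
  simp_rw [← inner_delta]
  exact continuous_const.inner (continuous_green V hV hε)

theorem norm_exp_I_mul (z : ℂ) (s : ℝ) :
    ‖Complex.exp (Complex.I * z * s)‖ = Real.exp (-z.im * s) := by
  rw [Complex.norm_exp]; simp

open MeasureTheory in
theorem integrableOn_exp_smul_psi (V : ℤ → ℝ) (hV : ∃ M : ℝ, ∀ n, |V n| ≤ M) {z : ℂ}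
    (hz : 0 < z.im) :
    IntegrableOn (fun s : ℝ => Complex.exp (Complex.I * z * s) • psi V hV s) (Set.Ioi 0) := by
  have hc : Continuous fun s : ℝ => Complex.exp (Complex.I * z * s) • psi V hV s :=
    (by fun_prop : Continuous fun s : ℝ => Complex.exp (Complex.I * z * s)).smul
      (continuous_psi V hV)
  refine (exp_neg_integrableOn_Ioi 0 hz).mono' hc.aestronglyMeasurable (ae_of_all _ fun s => ?_)
  rw [norm_smul, norm_exp_I_mul, norm_psi, mul_one]

open MeasureTheory in
/-- The Laplace transform of the evolution is the resolvent. -/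
theorem integral_exp_smul_psi (V : ℤ → ℝ) (hV : ∃ M : ℝ, ∀ n, |V n| ≤ M) {z : ℂ}
    (hz : 0 < z.im) :
    ∫ s in Set.Ioi (0 : ℝ), Complex.exp (Complex.I * z * s) • psi V hV s =
      Complex.I • green V hV z := by
  set H := hamiltonian V hV with hH
  set F : ℝ → L2Z := fun s => Complex.exp (Complex.I * z * s) • psi V hV s with hF
  have hint : IntegrableOn F (Set.Ioi 0) := integrableOn_exp_smul_psi V hV hz
  have hderiv : ∀ s : ℝ, HasDerivAt F (Complex.I • (z • F s - H (F s))) s := fun s => by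
    have h1 : HasDerivAt (fun s : ℝ => Complex.exp (Complex.I * z * s))
        (Complex.exp (Complex.I * z * s) * (Complex.I * z)) s := by
      have := ((hasDerivAt_id s).ofReal_comp.const_mul (Complex.I * z)).cexp
      simpa using this
    refine (h1.smul (hasDerivAt_psi V hV s)).congr_deriv ?_
    simp only [hF, map_smul, ← hH]
    module
  have hHint : IntegrableOn (fun s => H (F s)) (Set.Ioi 0) := H.integrable_comp hint
  have hlim : Tendsto F atTop (𝓝 0) := by
    rw [tendsto_zero_iff_norm_tendsto_zero]
    have : ∀ s, ‖F s‖ = Real.exp (-z.im * s) := fun s => by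
      rw [hF]; dsimp only; rw [norm_smul, norm_exp_I_mul, norm_psi, mul_one]
    simp_rw [this]
    exact Real.tendsto_exp_atBot.comp (tendsto_id.const_mul_atTop_of_neg (by linarith))
  -- Integrating F' = i(z - H)F over the half-line gives (z - H)Y = iδ_0 for the integral Y of F;
  -- injectivity of z - H then identifies Y.
  have h0 := integral_Ioi_of_hasDerivAt_of_tendsto' (a := 0) (fun s _ => hderiv s)
    (((hint.smul z).sub hHint).smul Complex.I) hlim
  have hF0 : F 0 = delta 0 := by simp [hF, psi_zero]
  rw [integral_smul, integral_sub (f := fun s => z • F s) (hint.smul z) hHint, integral_smul,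
    ContinuousLinearMap.integral_comp_comm H hint, hF0, zero_sub] at h0
  set Y := ∫ s in Set.Ioi (0 : ℝ), F s
  have h1 : z • (Y - Complex.I • green V hV z) - H (Y - Complex.I • green V hV z) = 0 := by
    have hg := green_eq V hV hz
    have h2 : z • Y - H Y = Complex.I • delta 0 := by
      rw [← neg_eq_iff_eq_neg.2 h0, ← smul_neg, smul_smul]
      simp
    rw [map_sub, map_smul, smul_sub, smul_comm z, sub_sub_sub_comm, h2, ← smul_sub, hg, sub_self]
  have h2 := im_mul_norm_le (isSelfAdjoint_hamiltonian V hV) z (Y - Complex.I • green V hV z)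
  rw [← hH, h1, norm_zero] at h2
  have h3 : ‖Y - Complex.I • green V hV z‖ ≤ 0 := by
    by_contra h
    nlinarith
  exact sub_eq_zero.1 (norm_le_zero_iff.1 h3)

open MeasureTheory in
theorem integral_exp_mul_psi_apply (V : ℤ → ℝ) (hV : ∃ M : ℝ, ∀ n, |V n| ≤ M) {z : ℂ}
    (hz : 0 < z.im) (n : ℤ) :
    ∫ s in Set.Ioi (0 : ℝ), Complex.exp (Complex.I * z * s) * psi V hV s n =
      Complex.I * green V hV z n := by
  have h := ContinuousLinearMap.integral_comp_comm (innerSL ℂ (delta n))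
    (integrableOn_exp_smul_psi V hV hz)
  rw [integral_exp_smul_psi V hV hz] at h
  simpa only [innerSL_apply_apply, inner_smul_right, inner_delta] using h

open MeasureTheory FourierTransform in
/-- Fourier inversion bounds the evolution by the integral of the Green function along a horizontal
line in the upper half plane. -/
theorem enorm_psi_le (V : ℤ → ℝ) (hV : ∃ M : ℝ, ∀ n, |V n| ≤ M) {ε t : ℝ} (hε : 0 < ε)
    (ht : 0 < t) (n : ℤ) :
    ‖psi V hV t n‖ₑ ≤ ENNReal.ofReal (Real.exp (ε * t)) *
      ∫⁻ E : ℝ, ‖green V hV ((E : ℂ) + Complex.I * (ε : ℂ)) n‖ₑ := by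
  set G : ℝ → ℂ := fun E => green V hV ((E : ℂ) + Complex.I * (ε : ℂ)) n with hG
  have hGc : Continuous G := continuous_green_apply V hV hε n
  -- If the right-hand side is infinite there is nothing to prove; otherwise finiteness supplies the
  -- integrability needed for inversion.
  by_cases htop : ∫⁻ E : ℝ, ‖G E‖ₑ = ⊤
  · rw [htop, ENNReal.mul_top]
    · exact le_top
    · simpa using Real.exp_pos _
  have hGi : Integrable G := ⟨hGc.aestronglyMeasurable, lt_top_iff_ne_top.2 htop⟩
  have hpc : Continuous fun s => psi V hV s n := by
    simp_rw [← inner_delta]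
    exact continuous_const.inner (continuous_psi V hV)
  set f0 : ℝ → ℂ := fun s => Complex.exp (Complex.I * (Complex.I * ε) * s) * psi V hV s n with hf0
  have hf0c : Continuous f0 := by rw [hf0]; fun_prop
  set f : ℝ → ℂ := (Set.Ioi 0).indicator f0 with hf
  have hfi : Integrable f := by
    rw [hf, integrable_indicator_iff measurableSet_Ioi]
    refine (exp_neg_integrableOn_Ioi 0 hε).mono' hf0c.aestronglyMeasurable
      (ae_of_all _ fun s => ?_)
    rw [hf0]; dsimp only
    rw [norm_mul, norm_exp_I_mul]
    have : ‖psi V hV s n‖ ≤ 1 :=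
      (lp.norm_apply_le_norm (by norm_num) _ n).trans (norm_psi V hV s).le
    simpa using mul_le_of_le_one_right (Real.exp_pos _).le this
  have hFf : 𝓕 f = fun w => Complex.I * G (-(2 * Real.pi) * w) := by
    ext w
    rw [Real.fourier_real_eq_integral_exp_smul]
    have e : ∀ v : ℝ, Complex.exp (↑(-2 * Real.pi * v * w) * Complex.I) • f v =
        (Set.Ioi 0).indicator (fun s : ℝ => Complex.exp (Complex.I *
          (((-(2 * Real.pi) * w : ℝ) : ℂ) + Complex.I * ε) * s) * psi V hV s n) v := fun v => by
      by_cases hv : v ∈ Set.Ioi (0 : ℝ)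
      · rw [hf, Set.indicator_of_mem hv, Set.indicator_of_mem hv, hf0, smul_eq_mul, ← mul_assoc,
          ← Complex.exp_add]
        congr 2
        push_cast
        ring
      · rw [hf, Set.indicator_of_notMem hv, Set.indicator_of_notMem hv, smul_zero]
    simp_rw [e]
    rw [integral_indicator measurableSet_Ioi, integral_exp_mul_psi_apply V hV (by simpa using hε)]
  have hπ : -(2 * Real.pi) ≠ 0 := by simp [Real.pi_ne_zero]
  have hFi : Integrable (𝓕 f) := by
    rw [hFf]
    exact (hGi.comp_mul_left' hπ).const_mul _
  -- The truncation to positive times may jump at 0, so inversion is applied pointwise at t > 0.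
  have hcont : ContinuousAt f t := hf0c.continuousAt.congr (by
    filter_upwards [Ioi_mem_nhds ht] with s hs
    rw [hf, Set.indicator_of_mem hs])
  have hinv := hfi.fourierInv_fourier_eq hFi hcont
  have hft : f t = Complex.exp (Complex.I * (Complex.I * ε) * t) * psi V hV t n := by
    rw [hf, Set.indicator_of_mem (Set.mem_Ioi.2 ht)]
  have h1 : ‖f t‖ₑ ≤ ∫⁻ E, ‖G E‖ₑ := by
    rw [← hinv, Real.fourierInv_eq']
    refine (enorm_integral_le_lintegral_enorm _).trans ?_
    have e : ∀ w : ℝ, ‖Complex.exp (↑(2 * Real.pi * inner ℝ w t) * Complex.I) • 𝓕 f w‖ₑ =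
        ‖G (-(2 * Real.pi) * w)‖ₑ := fun w => by
      rw [enorm_smul, hFf, enorm_mul, ← ofReal_norm, Complex.norm_exp_ofReal_mul_I,
        ← ofReal_norm (Complex.I), Complex.norm_I]
      simp
    simp_rw [e]
    rw [← lintegral_map (f := fun x => ‖G x‖ₑ) hGc.measurable.enorm (measurable_const_mul _),
      Real.map_volume_mul_left hπ, lintegral_smul_measure]
    -- The change of variable E = -2πw produces the factor 1/(2π), which is bounded by 1.
    refine mul_le_of_le_one_left (zero_le) ?_
    rw [← ENNReal.ofReal_one]
    refine ENNReal.ofReal_le_ofReal ?_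
    rw [abs_inv, abs_neg, abs_of_pos (by positivity)]
    exact inv_le_one_of_one_le₀ (by linarith [Real.pi_gt_three])
  have h2 : ‖psi V hV t n‖ₑ = ENNReal.ofReal (Real.exp (ε * t)) * ‖f t‖ₑ := by
    rw [hft, enorm_mul, ← ofReal_norm (Complex.exp _), norm_exp_I_mul, ← mul_assoc,
      ← ENNReal.ofReal_mul (Real.exp_pos _).le, ← Real.exp_add]
    simp
  rw [h2]
  gcongr

/-! ### Energies outside [-K, K] and the ballistic bound -/

/-- Two factors of order |E| combine: |z| itself, and the lower bound |E| - (K - 1) ≥ |E|/K for |E|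
≥ K. As E² ≥ 1, replacing E² by 1 + E² costs a factor 2. -/
theorem norm_green_outside_le {V : ℤ → ℝ} (hV : ∃ M : ℝ, ∀ n, |V n| ≤ M) {B : ℝ}
    (hB : ∀ n, |V n| ≤ B) {K : ℝ} (hK : 1 ≤ K) (hH : ‖hamiltonian V hV‖ ≤ K - 1) {ε E : ℝ}
    (hε : 0 < ε) (hE : K ≤ |E|) {n : ℤ} (hn : n ≠ 0) :
    ‖green V hV ((E : ℂ) + Complex.I * (ε : ℂ)) n‖ ≤
      4 * K * (3 + B) * (4 / 5) ^ n.natAbs * (1 + E ^ 2)⁻¹ := by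
  set z : ℂ := (E : ℂ) + Complex.I * (ε : ℂ) with hz
  have hre : z.re = E := by simp [hz]
  have him : z.im = ε := by simp [hz]
  have hB0 : 0 ≤ B := (abs_nonneg _).trans (hB 0)
  have hd : 1 ≤ |E| - (K - 1) := by linarith
  have h1 := combes_thomas_off_diagonal hV hB hd
    (fun y => by have := re_mul_norm_le _ hH z y; rwa [hre] at this)
    (green_eq V hV (him.symm ▸ hε)) hn
  have h2 : |E| ≤ ‖z‖ := by rw [← hre]; exact Complex.abs_re_le_norm z
  have hE0 : 0 < |E| := by linarith
  have h3 : 2 / (|E| - (K - 1)) ≤ 2 * K / |E| := by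
    rw [div_le_div_iff₀ (by linarith) hE0]
    nlinarith
  set x := ‖green V hV z n‖
  have h4 : |E| * x ≤ 2 * K / |E| * (3 + B) * (4 / 5) ^ n.natAbs :=
    (mul_le_mul_of_nonneg_right h2 (norm_nonneg _)).trans (h1.trans (by gcongr))
  have h5 : E ^ 2 * x ≤ 2 * K * (3 + B) * (4 / 5) ^ n.natAbs := by
    have := mul_le_mul_of_nonneg_left h4 hE0.le
    calc E ^ 2 * x = |E| * (|E| * x) := by rw [← sq_abs]; ring
      _ ≤ _ := this
      _ = _ := by field_simp
  rw [← div_eq_mul_inv, le_div_iff₀ (by positivity)]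
  have h6 : 1 ≤ E ^ 2 := by rw [← sq_abs]; nlinarith
  have h7 : 0 ≤ x := norm_nonneg _
  nlinarith

theorem norm_green_one_le (V : ℤ → ℝ) (hV : ∃ M : ℝ, ∀ n, |V n| ≤ M) (E : ℝ) (n : ℤ) :
    ‖green V hV ((E : ℂ) + Complex.I * ((1 : ℝ) : ℂ)) n‖ ≤ 2 * (4 / 5) ^ n.natAbs := by
  set z : ℂ := (E : ℂ) + Complex.I * ((1 : ℝ) : ℂ) with hz
  have him : z.im = 1 := by simp [hz]
  have h := combes_thomas V hV le_rfl
    (fun y => by have := im_mul_norm_le (isSelfAdjoint_hamiltonian V hV) z y; rwa [him] at this)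
    (green_eq V hV (him.symm ▸ one_pos)) n
  simpa using h

open MeasureTheory in
theorem lintegral_green_outside_le {V : ℤ → ℝ} (hV : ∃ M : ℝ, ∀ n, |V n| ≤ M) {B : ℝ}
    (hB : ∀ n, |V n| ≤ B) {K : ℝ} (hK : 1 ≤ K) (hH : ‖hamiltonian V hV‖ ≤ K - 1) {ε : ℝ}
    (hε : 0 < ε) {n : ℤ} (hn : n ≠ 0) :
    ∫⁻ E : ℝ in (Set.Icc (-K) K)ᶜ, ‖green V hV ((E : ℂ) + Complex.I * (ε : ℂ)) n‖ₑ ≤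
      ENNReal.ofReal (4 * K * (3 + B) * Real.pi * (4 / 5) ^ n.natAbs) := by
  have hB0 : 0 ≤ B := (abs_nonneg _).trans (hB 0)
  calc _ ≤ ∫⁻ E : ℝ in (Set.Icc (-K) K)ᶜ,
        ENNReal.ofReal (4 * K * (3 + B) * (4 / 5) ^ n.natAbs * (1 + E ^ 2)⁻¹) := by
        refine setLIntegral_mono' measurableSet_Icc.compl fun E hE => ?_
        rw [← ofReal_norm]
        refine ENNReal.ofReal_le_ofReal (norm_green_outside_le hV hB hK hH hε ?_ hn)
        by_contra h
        exact hE (abs_le.1 (not_le.1 h).le)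
    _ ≤ ∫⁻ E : ℝ, ENNReal.ofReal (4 * K * (3 + B) * (4 / 5) ^ n.natAbs * (1 + E ^ 2)⁻¹) :=
        setLIntegral_le_lintegral _ _
    _ = ENNReal.ofReal (4 * K * (3 + B) * (4 / 5) ^ n.natAbs * Real.pi) := by
        rw [← ofReal_integral_eq_lintegral_ofReal (integrable_inv_one_add_sq.const_mul _)
          (ae_of_all _ fun E => by positivity), integral_const_mul, integral_univ_inv_one_add_sq]
    _ = _ := by congr 1; ring

open MeasureTheory in
/-- Ballistic upper bound: the evolution is exponentially small beyond a multiple of `t`. -/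
theorem exists_norm_psi_le {V : ℤ → ℝ} (hV : ∃ M : ℝ, ∀ n, |V n| ≤ M) {K : ℝ} (hK : 1 ≤ K)
    (hH : ‖hamiltonian V hV‖ ≤ K - 1) :
    ∃ C : ℝ, 0 ≤ C ∧ ∀ t : ℝ, 0 < t → ∀ n : ℤ, n ≠ 0 →
      ‖psi V hV t n‖ ≤ C * Real.exp t * (4 / 5) ^ n.natAbs := by
  obtain ⟨B, hB⟩ := id hV
  have hB0 : 0 ≤ B := (abs_nonneg _).trans (hB 0)
  refine ⟨4 * K + 4 * K * (3 + B) * Real.pi, by positivity, fun t ht n hn => ?_⟩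
  -- On the line Im z = 1 Combes-Thomas holds at every energy; the price is the factor e^t.
  have h1 := enorm_psi_le V hV one_pos ht n
  rw [← lintegral_add_compl _ (measurableSet_Icc (a := -K) (b := K))] at h1
  have h2 : ∫⁻ E : ℝ in Set.Icc (-K) K, ‖green V hV ((E : ℂ) + Complex.I * ((1 : ℝ) : ℂ)) n‖ₑ ≤
      ENNReal.ofReal (4 * K * (4 / 5) ^ n.natAbs) := by
    calc _ ≤ ∫⁻ E : ℝ in Set.Icc (-K) K, ENNReal.ofReal (2 * (4 / 5) ^ n.natAbs) := by
          refine lintegral_mono fun E => ?_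
          rw [← ofReal_norm]
          exact ENNReal.ofReal_le_ofReal (norm_green_one_le V hV E n)
      _ = _ := by
          rw [setLIntegral_const, Real.volume_Icc, ← ENNReal.ofReal_mul (by positivity)]
          congr 1; ring
  have h3 := h1.trans (mul_le_mul_right
    (add_le_add h2 (lintegral_green_outside_le hV hB hK hH one_pos hn)) _)
  rw [← ENNReal.ofReal_add (by positivity) (by positivity),
    ← ENNReal.ofReal_mul (Real.exp_pos _).le, ← ofReal_norm,
    ENNReal.ofReal_le_ofReal_iff (by positivity)] at h3
  calc _ ≤ _ := h3
    _ = _ := by rw [one_mul]; ring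

/-! ### Mass of the evolution from the energy window [-K, K] -/

theorem ennreal_add_sq_le (a b : ℝ≥0∞) : (a + b) ^ 2 ≤ 2 * (a ^ 2 + b ^ 2) := by
  rcases eq_or_ne a ⊤ with rfl | ha
  · simp
  rcases eq_or_ne b ⊤ with rfl | hb
  · simp
  lift a to ℝ≥0 using ha
  lift b to ℝ≥0 using hb
  norm_cast
  exact add_sq_le

open MeasureTheory in
-- Cauchy-Schwarz against the constant 1 on an interval of length 2K.
theorem sq_lintegral_Icc_le {K : ℝ} {f : ℝ → ℝ≥0∞} (hf : Measurable f) :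
    (∫⁻ E in Set.Icc (-K) K, f E) ^ 2 ≤
      ENNReal.ofReal (2 * K) * ∫⁻ E in Set.Icc (-K) K, f E ^ 2 := by
  have h := ENNReal.lintegral_mul_le_Lp_mul_Lq (volume.restrict (Set.Icc (-K) K))
    Real.HolderConjugate.two_two hf.aemeasurable (aemeasurable_const (b := (1 : ℝ≥0∞)))
  have h2 : (∫⁻ E in Set.Icc (-K) K, f E) ^ 2 ≤ ((∫⁻ E in Set.Icc (-K) K, f E ^ 2) ^ (1 / 2 : ℝ) *
      (ENNReal.ofReal (2 * K)) ^ (1 / 2 : ℝ)) ^ 2 := by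
    gcongr
    have e : K - -K = 2 * K := by ring
    simpa [e] using h
  refine h2.trans (le_of_eq ?_)
  rw [mul_pow, ← ENNReal.rpow_natCast, ← ENNReal.rpow_natCast, ← ENNReal.rpow_mul,
    ← ENNReal.rpow_mul]
  norm_num
  rw [mul_comm]

theorem tsum_geometric_natAbs : ∃ c : ℝ, 0 ≤ c ∧
    ∑' n : ℤ, ENNReal.ofReal ((4 / 5) ^ n.natAbs) ≤ ENNReal.ofReal c := by
  have h : Summable fun n : ℤ => (4 / 5 : ℝ) ^ n.natAbs := by
    have hg : Summable fun n : ℕ => (4 / 5 : ℝ) ^ n :=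
      summable_geometric_of_lt_one (by norm_num) (by norm_num)
    exact Summable.of_nat_of_neg (by simpa using hg) (by simpa using hg)
  refine ⟨∑' n : ℤ, (4 / 5 : ℝ) ^ n.natAbs, tsum_nonneg fun n => by positivity, ?_⟩
  rw [ENNReal.ofReal_tsum_of_nonneg (fun n => by positivity) h]

/-- One factor of each square is bounded by its largest value (4/5)^x, and the other is summed. -/
theorem tsum_geometric_sq_le {c : ℝ}
    (hc : ∑' n : ℤ, ENNReal.ofReal ((4 / 5) ^ n.natAbs) ≤ ENNReal.ofReal c) {x : ℝ} {S : Set ℤ}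
    (hS : ∀ n ∈ S, x ≤ (n.natAbs : ℝ)) :
    ∑' n : S, ENNReal.ofReal ((4 / 5) ^ (n : ℤ).natAbs) ^ 2 ≤
      ENNReal.ofReal ((4 / 5) ^ x * c) := by
  rw [ENNReal.ofReal_mul (by positivity)]
  refine le_trans ?_ (mul_le_mul_right hc _)
  rw [← ENNReal.tsum_mul_left]
  refine le_trans (ENNReal.tsum_le_tsum fun n => ?_)
    (ENNReal.tsum_comp_le_tsum_of_injective (f := ((↑) : S → ℤ)) Subtype.val_injective _)
  rw [sq]
  gcongr
  rw [← Real.rpow_natCast]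
  exact Real.rpow_le_rpow_of_exponent_ge (by norm_num) (by norm_num) (hS n n.2)

open MeasureTheory in
/-- The mass of the evolution in a set away from the origin, in terms of the Green function on the
line `Im z = 1 / t`. -/
theorem exists_mass_psi_le {V : ℤ → ℝ} (hV : ∃ M : ℝ, ∀ n, |V n| ≤ M) {K : ℝ} (hK : 1 ≤ K)
    (hH : ‖hamiltonian V hV‖ ≤ K - 1) :
    ∃ C : ℝ, 0 ≤ C ∧ ∀ t x : ℝ, 0 < t → 0 < x → ∀ S : Set ℤ, (∀ n ∈ S, x ≤ (n.natAbs : ℝ)) →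
      mass (psi V hV t) S ≤ ENNReal.ofReal C * ((∫⁻ E in Set.Icc (-K) K,
        mass (green V hV ((E : ℂ) + Complex.I * ((t⁻¹ : ℝ) : ℂ))) S) +
        ENNReal.ofReal ((4 / 5) ^ x)) := by
  obtain ⟨B, hB⟩ := id hV
  have hB0 : 0 ≤ B := (abs_nonneg _).trans (hB 0)
  obtain ⟨c, hc0, hc⟩ := tsum_geometric_natAbs
  set A := 4 * K * (3 + B) * Real.pi with hA
  have hA0 : 0 ≤ A := by positivity
  refine ⟨Real.exp 1 ^ 2 * (2 * (2 * K + A ^ 2 * c)), by positivity, fun t x ht hx S hS => ?_⟩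
  set g : ℤ → ℝ → ℝ≥0∞ := fun n E =>
    ‖green V hV ((E : ℂ) + Complex.I * ((t⁻¹ : ℝ) : ℂ)) n‖ₑ with hg
  have hgm : ∀ n, Measurable (g n) := fun n =>
    (continuous_green_apply V hV (inv_pos.2 ht) n).measurable.enorm
  have hpt : ∀ n : S, ‖psi V hV t n‖ₑ ^ 2 ≤ ENNReal.ofReal (Real.exp 1 ^ 2) * (2 *
      (ENNReal.ofReal (2 * K) * (∫⁻ E in Set.Icc (-K) K, g n E ^ 2) +
        ENNReal.ofReal (A ^ 2) * ENNReal.ofReal ((4 / 5) ^ (n : ℤ).natAbs) ^ 2)) := fun n => by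
    have hn : (n : ℤ) ≠ 0 := fun h0 => by
      have := hS n n.2
      rw [h0] at this
      simp at this
      linarith
    have h1 := enorm_psi_le V hV (inv_pos.2 ht) ht n
    -- With ε = 1/t the factor e^{εt} is the constant e.
    rw [inv_mul_cancel₀ ht.ne', ← lintegral_add_compl _ (measurableSet_Icc (a := -K) (b := K))]
      at h1
    have h2 := h1.trans (mul_le_mul_right (add_le_add_right
      (lintegral_green_outside_le hV hB hK hH (inv_pos.2 ht) hn) _) _)
    calc _ ≤ _ := pow_le_pow_left' h2 2
      _ ≤ _ := by
        rw [mul_pow, ← ENNReal.ofReal_pow (Real.exp_pos _).le]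
        gcongr
        refine (ennreal_add_sq_le _ _).trans ?_
        gcongr
        · exact sq_lintegral_Icc_le (hgm n)
        · rw [ENNReal.ofReal_mul hA0, mul_pow, ENNReal.ofReal_pow hA0]
  have hsum : mass (psi V hV t) S ≤ ENNReal.ofReal (Real.exp 1 ^ 2) * (2 *
      (ENNReal.ofReal (2 * K) * (∫⁻ E in Set.Icc (-K) K,
        mass (green V hV ((E : ℂ) + Complex.I * ((t⁻¹ : ℝ) : ℂ))) S) +
        ENNReal.ofReal (A ^ 2) * ENNReal.ofReal ((4 / 5) ^ x * c))) := by
    refine (ENNReal.tsum_le_tsum hpt).trans ?_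
    rw [ENNReal.tsum_mul_left, ENNReal.tsum_mul_left, ENNReal.tsum_add, ENNReal.tsum_mul_left,
      ENNReal.tsum_mul_left, ← lintegral_tsum fun n : S => ((hgm n).pow_const 2).aemeasurable]
    gcongr
    · exact le_rfl
    · exact tsum_geometric_sq_le hc hS
  refine hsum.trans ?_
  set I := ∫⁻ E in Set.Icc (-K) K,
    mass (green V hV ((E : ℂ) + Complex.I * ((t⁻¹ : ℝ) : ℂ))) S
  have hconst : ENNReal.ofReal (Real.exp 1 ^ 2 * (2 * (2 * K + A ^ 2 * c))) =
      ENNReal.ofReal (Real.exp 1 ^ 2) * (2 * (ENNReal.ofReal (2 * K) +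
        ENNReal.ofReal (A ^ 2) * ENNReal.ofReal c)) := by
    rw [ENNReal.ofReal_mul (by positivity), ENNReal.ofReal_mul (by positivity),
      ENNReal.ofReal_ofNat, ENNReal.ofReal_add (by positivity) (by positivity),
      ENNReal.ofReal_mul (p := A ^ 2) (by positivity)]
  rw [hconst, ENNReal.ofReal_mul (p := (4 / 5 : ℝ) ^ x) (by positivity), mul_assoc, mul_assoc]
  gcongr
  rw [mul_add, mul_left_comm, mul_comm (ENNReal.ofReal ((4 / 5) ^ x))]
  exact add_le_add (mul_le_mul_left le_self_add _) (mul_le_mul_left le_add_self _)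

/-! ### Positivity and continuity of the transfer matrix maxima -/

theorem det_stepMatrix (V : ℤ → ℝ) (z : ℂ) (m : ℤ) : (stepMatrix V z m).det = 1 := by
  simp [stepMatrix, Matrix.det_fin_two]

theorem det_transfer_natCast (V : ℤ → ℝ) (z : ℂ) (n : ℕ) : (transfer V z n).det = 1 := by
  rw [Matrix.det_fin_two]
  exact det_transferPos V z n

theorem det_transfer_neg_natCast (V : ℤ → ℝ) (z : ℂ) (n : ℕ) :
    (transfer V z (-(n : ℤ))).det = 1 := by
  cases n with
  | zero => simpa using det_transfer_natCast V z 0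
  | succ n =>
    have h := det_transfer_natCast (fun m => V (-m)) z n
    rw [transfer_neg_natCast_succ, transferNeg_succ_eq, Matrix.det_mul, Matrix.det_mul,
      Matrix.det_mul, det_stepMatrix,
      show (transferPos (fun m => V (-m)) z n).det = 1 from h]
    simp [swapMatrix]

/-- Since 0⁻¹ = 0 by convention, the inverse of a maximum bounds the mass only when the maximum is
nonzero. -/
theorem transferNormSq_pos {V : ℤ → ℝ} {z : ℂ} {n : ℤ} (h : (transfer V z n).det = 1) :
    0 < transferNormSq V z n := by
  refine pow_pos (pos_iff_ne_zero.2 fun h0 => ?_) 2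
  rw [nnnorm_eq_zero, map_eq_zero_iff _ (EquivLike.injective _)] at h0
  rw [h0] at h
  simp at h

theorem continuous_stepMatrix (V : ℤ → ℝ) (m : ℤ) : Continuous fun z => stepMatrix V z m := by
  refine continuous_matrix fun i j => ?_
  fin_cases i <;> fin_cases j <;> simp [stepMatrix] <;> fun_prop

theorem continuous_transferPos (V : ℤ → ℝ) (n : ℕ) : Continuous fun z => transferPos V z n := by
  induction n with
  | zero => exact continuous_const
  | succ n ih => exact (continuous_stepMatrix V _).matrix_mul ih

theorem continuous_transferNeg (V : ℤ → ℝ) (n : ℕ) : Continuous fun z => transferNeg V z n := by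
  cases n with
  | zero => exact continuous_const
  | succ n =>
    simp_rw [transferNeg_succ_eq]
    exact (continuous_const.matrix_mul
      ((continuous_transferPos _ n).matrix_mul (continuous_stepMatrix V 0))).matrix_mul
      continuous_const

theorem continuous_transferNormSq (V : ℤ → ℝ) (n : ℤ) :
    Continuous fun z => transferNormSq V z n := by
  have h1 : Continuous fun z => transfer V z n := by
    cases n with
    | ofNat n => exact continuous_transferPos V n
    | negSucc n => exact continuous_transferNeg V (n + 1)
  have h2 : Continuous (Matrix.toEuclideanCLM (n := Fin 2) (𝕜 := ℂ)) :=
    LinearMap.continuous_of_finiteDimensional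
      { toFun := Matrix.toEuclideanCLM (n := Fin 2) (𝕜 := ℂ)
        map_add' := map_add _
        map_smul' := map_smul _ }
  exact ((h2.comp h1).nnnorm).pow 2

theorem continuous_maxRight (V : ℤ → ℝ) (L : ℝ) : Continuous fun z => maxRight V z L :=
  Continuous.finset_sup_apply fun n _ => continuous_transferNormSq V n

theorem continuous_maxLeft (V : ℤ → ℝ) (L : ℝ) : Continuous fun z => maxLeft V z L :=
  Continuous.finset_sup_apply fun n _ => continuous_transferNormSq V (-n)

theorem maxRight_pos (V : ℤ → ℝ) (z : ℂ) {L : ℝ} (hL : 1 ≤ L) : 0 < maxRight V z L :=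
  (transferNormSq_pos (det_transfer_natCast V z 1)).trans_le
    (Finset.le_sup (f := fun n : ℕ => transferNormSq V z (n : ℤ))
      (Finset.mem_Icc.2 ⟨le_rfl, (Nat.le_floor_iff' one_ne_zero).2 (by simpa using hL)⟩))

theorem maxLeft_pos (V : ℤ → ℝ) (z : ℂ) {L : ℝ} (hL : 1 ≤ L) : 0 < maxLeft V z L :=
  (transferNormSq_pos (det_transfer_neg_natCast V z 1)).trans_le
    (Finset.le_sup (f := fun n : ℕ => transferNormSq V z (-(n : ℤ)))
      (Finset.mem_Icc.2 ⟨le_rfl, (Nat.le_floor_iff' one_ne_zero).2 (by simpa using hL)⟩))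

/-! ### Superpolynomial decay of the outside probability -/

open MeasureTheory in
-- Continuity and positivity of M make its inverse integrable on [-K, K], so the interval integral
-- is a genuine value and not the default 0.
theorem lintegral_le_integral_inv {K X : ℝ} (hK : 0 ≤ K) (hX : 0 ≤ X) {f : ℝ → ℝ≥0∞}
    {M : ℝ → ℝ≥0} (hMc : Continuous M) (hM0 : ∀ E, 0 < M E)
    (h : ∀ E ∈ Set.Icc (-K) K, f E * M E ≤ ENNReal.ofReal X) :
    ∫⁻ E in Set.Icc (-K) K, f E ≤ ENNReal.ofReal (X * ∫ E in (-K)..K, (M E : ℝ)⁻¹) := by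
  have hc : Continuous fun E => X * (M E : ℝ)⁻¹ :=
    continuous_const.mul ((NNReal.continuous_coe.comp hMc).inv₀ fun E => by
      simpa using (hM0 E).ne')
  rw [← intervalIntegral.integral_const_mul, intervalIntegral.integral_of_le (by linarith),
    ← integral_Icc_eq_integral_Ioc, ofReal_integral_eq_lintegral_ofReal
      hc.continuousOn.integrableOn_Icc (ae_of_all _ fun E => by positivity)]
  refine setLIntegral_mono' measurableSet_Icc fun E hE => ?_
  have h0 : (M E : ℝ≥0∞) ≠ 0 := by simpa using (hM0 E).ne'
  refine ((ENNReal.le_div_iff_mul_le (Or.inl h0) (Or.inl ENNReal.coe_ne_top)).2 (h E hE)).trans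
    (le_of_eq ?_)
  rw [← div_eq_mul_inv, ENNReal.ofReal_div_of_pos (by exact_mod_cast hM0 E),
    ENNReal.ofReal_coe_nnreal]

theorem isBigO_exp_decay {a : ℝ} (ha : 0 < a) (m : ℕ) :
    (fun t : ℝ => (4 / 5 : ℝ) ^ (t ^ a - 1)) =O[atTop] fun t : ℝ => (t ^ m)⁻¹ := by
  have hb : 0 < Real.log (5 / 4) := Real.log_pos (by norm_num)
  have h1 := (isLittleO_exp_neg_mul_rpow_atTop hb (-(m / a))).comp_tendsto (tendsto_rpow_atTop ha)
  have h2 : (fun t : ℝ => (4 / 5 : ℝ) ^ (t ^ a - 1)) =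
      fun t => 5 / 4 * Real.exp (-Real.log (5 / 4) * t ^ a) := by
    ext t
    rw [Real.rpow_sub_one (by norm_num), Real.rpow_def_of_pos (by norm_num),
      show (4 / 5 : ℝ) = (5 / 4)⁻¹ by norm_num, Real.log_inv]
    ring
  rw [h2]
  refine IsBigO.const_mul_left (h1.isBigO.congr' (by rfl) ?_) _
  filter_upwards [eventually_gt_atTop 0] with t ht
  simp only [Function.comp_apply]
  rw [← Real.rpow_mul ht.le, ← Real.rpow_natCast, ← Real.rpow_neg ht.le]
  congr 1
  field_simp

theorem natAbs_cast_eq_abs (n : ℤ) : ((n.natAbs : ℕ) : ℝ) = |(n : ℝ)| := by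
  rw [Nat.cast_natAbs, Int.cast_abs]

open MeasureTheory in
/-- If the inverse of the maximum `M` of the transfer matrices has superpolynomially small integral
and `M` controls the Green function beyond `t ^ a - 1`, then the mass there is superpolynomially
small. -/
theorem eventually_mass_le {V : ℤ → ℝ} (hV : ∃ M : ℝ, ∀ n, |V n| ≤ M) {K : ℝ} (hK : 1 ≤ K)
    (hH : ‖hamiltonian V hV‖ ≤ K - 1) {a D : ℝ} (ha : 0 < a) (hD : 0 ≤ D)
    {M : ℝ → ℝ → ℝ≥0} {S : ℝ → Set ℤ} (hS : ∀ t, ∀ n ∈ S t, t ^ a - 1 ≤ |(n : ℝ)|)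
    (hMc : ∀ t, Continuous (M t)) (hM0 : ∀ᶠ t in atTop, ∀ E, 0 < M t E)
    (hM : ∀ᶠ t in atTop, ∀ E ∈ Set.Icc (-K) K,
      mass (green V hV ((E : ℂ) + Complex.I * ((t⁻¹ : ℝ) : ℂ))) (S t) * M t E ≤
        ENNReal.ofReal (D * t ^ 4))
    (hint : ∀ m : ℕ, 1 ≤ m → (fun t : ℝ => ∫ E in (-K)..K, (M t E : ℝ)⁻¹)
      =O[atTop] fun t : ℝ => (t ^ m)⁻¹) (m : ℕ) :
    ∀ᶠ t in atTop, mass (psi V hV t) (S t) ≤ ENNReal.ofReal ((t ^ m)⁻¹) := by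
  obtain ⟨C, hC0, hC⟩ := exists_mass_psi_le hV hK hH
  have hO : (fun t : ℝ => C * (D * t ^ 4 * (∫ E in (-K)..K, (M t E : ℝ)⁻¹) +
      (4 / 5 : ℝ) ^ (t ^ a - 1))) =O[atTop] fun t : ℝ => (t ^ (m + 1))⁻¹ := by
    refine IsBigO.const_mul_left (IsBigO.add ?_ (isBigO_exp_decay ha (m + 1))) _
    have h1 : (fun t : ℝ => D * t ^ 4) =O[atTop] fun t : ℝ => t ^ 4 :=
      (isBigO_refl _ _).const_mul_left _
    -- Four of the m + 5 powers pay for t^4; of the remaining m + 1, one will absorb the implied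
    -- constant c, since eventually c ≤ t.
    refine (h1.mul (hint (m + 5) (by omega))).congr' (by rfl) ?_
    filter_upwards [eventually_gt_atTop 0] with t ht
    field_simp
    ring
  obtain ⟨c, hc⟩ := hO.bound
  have hta : ∀ᶠ t : ℝ in atTop, 1 < t ^ a := (tendsto_rpow_atTop ha).eventually_gt_atTop 1
  filter_upwards [hc, hM, hM0, hta, eventually_ge_atTop (max c 1)] with t h1 h2 h3 h4 h5
  have ht1 : 1 ≤ t := (le_max_right _ _).trans h5
  have htc : c ≤ t := (le_max_left _ _).trans h5
  have ht : 0 < t := by linarith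
  have hI0 : 0 ≤ ∫ E in (-K)..K, (M t E : ℝ)⁻¹ :=
    intervalIntegral.integral_nonneg (by linarith) fun E _ => by positivity
  have h6 := hC t (t ^ a - 1) ht (by linarith) (S t) fun n hn => by
    rw [natAbs_cast_eq_abs]; exact hS t n hn
  have h7 := lintegral_le_integral_inv (by linarith) (by positivity) (hMc t) h3 h2
  refine (h6.trans (mul_le_mul_right (add_le_add_left h7 _) _)).trans ?_
  rw [← ENNReal.ofReal_add (by positivity) (by positivity), ← ENNReal.ofReal_mul hC0]
  refine ENNReal.ofReal_le_ofReal ((le_abs_self _).trans (h1.trans ?_))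
  rw [Real.norm_eq_abs, abs_of_pos (by positivity), pow_succ, mul_inv]
  calc c * ((t ^ m)⁻¹ * t⁻¹) ≤ t * ((t ^ m)⁻¹ * t⁻¹) := by gcongr
    _ = _ := by field_simp

theorem probRight_eq (V : ℤ → ℝ) (hV : ∃ M : ℝ, ∀ n, |V n| ≤ M) (N t : ℝ) :
    probRight V hV N t = mass (psi V hV t) {n | N ≤ (n : ℝ)} :=
  tsum_congr fun n => by rw [prob, inner_delta, enorm_sq_eq_ofReal]

theorem probLeft_eq (V : ℤ → ℝ) (hV : ∃ M : ℝ, ∀ n, |V n| ≤ M) (N t : ℝ) :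
    probLeft V hV N t = mass (psi V hV t) {n | (n : ℝ) ≤ -N} :=
  tsum_congr fun n => by rw [prob, inner_delta, enorm_sq_eq_ofReal]

/-- Places the sites beyond t^a - 1 beyond every cut up to Ct^α; it also absorbs constants in the
moment bound. -/
theorem eventually_lt_rpow_sub_one {a α C : ℝ} (hα : 0 < α) (ha : α < a) :
    ∀ᶠ t : ℝ in atTop, C * t ^ α < t ^ a - 1 := by
  have h1 : Tendsto (fun t : ℝ => t ^ (a - α) - C) atTop atTop :=
    tendsto_atTop_add_const_right _ _ (tendsto_rpow_atTop (by linarith))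
  filter_upwards [h1.eventually_gt_atTop 1, (tendsto_rpow_atTop hα).eventually_gt_atTop 1,
    eventually_gt_atTop 0] with t h2 h3 ht
  have : t ^ a = t ^ (a - α) * t ^ α := by rw [← Real.rpow_add ht]; congr 1; ring
  nlinarith

/-- The outside probability beyond `t ^ a`, `a > α`, is superpolynomially small. -/
theorem eventually_probOutside_le {V : ℤ → ℝ} (hV : ∃ M : ℝ, ∀ n, |V n| ≤ M) {K : ℝ} (hK : 1 ≤ K)
    (hH : ‖hamiltonian V hV‖ ≤ K - 1) {C α : ℝ} (hC : 0 < C) (hα : 0 < α)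
    (hright : ∀ m : ℕ, 1 ≤ m →
      (fun t : ℝ => ∫ E in (-K)..K,
        ((maxRight V ((E : ℂ) + Complex.I * ((t⁻¹ : ℝ) : ℂ)) (C * t ^ α) : ℝ))⁻¹)
        =O[atTop] fun t : ℝ => (t ^ m)⁻¹)
    (hleft : ∀ m : ℕ, 1 ≤ m →
      (fun t : ℝ => ∫ E in (-K)..K,
        ((maxLeft V ((E : ℂ) + Complex.I * ((t⁻¹ : ℝ) : ℂ)) (C * t ^ α) : ℝ))⁻¹)
        =O[atTop] fun t : ℝ => (t ^ m)⁻¹) {a : ℝ} (ha : α < a) (m : ℕ) :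
    ∀ᶠ t in atTop, probOutside V hV (t ^ a - 1) t ≤ ENNReal.ofReal ((t ^ m)⁻¹) := by
  obtain ⟨B, hB⟩ := id hV
  have hB0 : 0 ≤ B := (abs_nonneg _).trans (hB 0)
  -- The constant from the left tail, with |z - V(0)| ≤ K + 1 + B on the window; it also exceeds the
  -- constant 2 of the right tail.
  set D := 4 * ((K + 1 + B) ^ 2 + 2) * 2 with hD
  have hline : ∀ t : ℝ, Continuous fun E : ℝ => (E : ℂ) + Complex.I * ((t⁻¹ : ℝ) : ℂ) :=
    fun t => by fun_prop
  have hL : ∀ᶠ t : ℝ in atTop, 1 ≤ C * t ^ α :=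
    ((tendsto_rpow_atTop hα).const_mul_atTop hC).eventually_ge_atTop 1
  have hnorm : ∀ t : ℝ, 1 ≤ t → ∀ E ∈ Set.Icc (-K) K,
      ‖(E : ℂ) + Complex.I * ((t⁻¹ : ℝ) : ℂ) - V 0‖ ≤ K + 1 + B := fun t ht E hE => by
    have e1 : ‖(E : ℂ)‖ ≤ K := by simpa using abs_le.2 hE
    have e2 : ‖Complex.I * ((t⁻¹ : ℝ) : ℂ)‖ ≤ 1 := by
      rw [norm_mul, Complex.norm_I, one_mul, Complex.norm_real, Real.norm_eq_abs,
        abs_of_pos (inv_pos.2 (by linarith))]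
      exact inv_le_one_of_one_le₀ ht
    have e3 : ‖((V 0 : ℝ) : ℂ)‖ ≤ B := by simpa using hB 0
    exact (norm_sub_le _ _).trans (add_le_add ((norm_add_le _ _).trans (add_le_add e1 e2)) e3)
  have hR := eventually_mass_le hV hK hH (hα.trans ha) (by positivity : (0 : ℝ) ≤ D)
    (M := fun t E => maxRight V ((E : ℂ) + Complex.I * ((t⁻¹ : ℝ) : ℂ)) (C * t ^ α))
    (S := fun t => {n | t ^ a - 1 ≤ (n : ℝ)}) (fun t n hn => le_trans hn (le_abs_self _))
    (fun t => (continuous_maxRight V _).comp (hline t))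
    (hL.mono fun t ht E => maxRight_pos V _ ht)
    (by
      filter_upwards [eventually_ge_atTop 1, eventually_lt_rpow_sub_one (C := C) hα ha]
        with t ht1 ht2 E hE
      have ht : 0 < t⁻¹ := inv_pos.2 (by linarith)
      refine (mass_mul_maxRight_le V hV (by simpa using ht)
        (by simpa using inv_le_one_of_one_le₀ ht1) (green_eq V hV (by simpa using ht))
        (fun n hn => ht2.trans_le hn)).trans (ENNReal.ofReal_le_ofReal ?_)
      have : (2 : ℝ) ≤ D := by nlinarith [sq_nonneg (K + 1 + B)]
      simp only [Complex.add_im, Complex.ofReal_im, Complex.mul_im, Complex.I_re, Complex.I_im,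
        Complex.ofReal_re]
      norm_num
      gcongr) hright (m + 1)
  have hLft := eventually_mass_le hV hK hH (hα.trans ha) (by positivity : (0 : ℝ) ≤ D)
    (M := fun t E => maxLeft V ((E : ℂ) + Complex.I * ((t⁻¹ : ℝ) : ℂ)) (C * t ^ α))
    (S := fun t => {n | (n : ℝ) ≤ -(t ^ a - 1)})
    (fun t n hn => (le_neg.1 hn).trans (neg_le_abs _))
    (fun t => (continuous_maxLeft V _).comp (hline t))
    (hL.mono fun t ht E => maxLeft_pos V _ ht)
    (by
      filter_upwards [eventually_ge_atTop 1, eventually_lt_rpow_sub_one (C := C) hα ha]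
        with t ht1 ht2 E hE
      have ht : 0 < t⁻¹ := inv_pos.2 (by linarith)
      refine (mass_mul_maxLeft_le V hV (by simpa using ht)
        (by simpa using inv_le_one_of_one_le₀ ht1) (green_eq V hV (by simpa using ht))
        (fun n hn => lt_of_le_of_lt hn (neg_lt_neg ht2))).trans (ENNReal.ofReal_le_ofReal ?_)
      have him : ((E : ℂ) + Complex.I * ((t⁻¹ : ℝ) : ℂ)).im = t⁻¹ := by simp
      rw [him, inv_inv, hD, ← mul_assoc]
      gcongr
      exact hnorm t ht1 E hE) hleft (m + 1)
  -- Both tails are at most t^{-(m+1)}, and 2t^{-(m+1)} ≤ t^{-m} once t ≥ 2.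
  filter_upwards [hR, hLft, eventually_ge_atTop 2] with t h1 h2 ht
  rw [probOutside, probLeft_eq, probRight_eq]
  refine (add_le_add h2 h1).trans ?_
  rw [← ENNReal.ofReal_add (by positivity) (by positivity)]
  refine ENNReal.ofReal_le_ofReal ?_
  rw [pow_succ, mul_inv]
  have h3 : t⁻¹ ≤ 1 / 2 := by rw [one_div]; gcongr
  have h4 : 0 ≤ (t ^ m)⁻¹ := by positivity
  nlinarith

/-! ### Moments of the position operator -/

theorem prob_eq (V : ℤ → ℝ) (hV : ∃ M : ℝ, ∀ n, |V n| ≤ M) (t : ℝ) (n : ℤ) :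
    prob V hV t n = ‖psi V hV t n‖ ^ 2 := by rw [prob, inner_delta]

theorem tsum_prob (V : ℤ → ℝ) (hV : ∃ M : ℝ, ∀ n, |V n| ≤ M) (t : ℝ) :
    ∑' n, ENNReal.ofReal (prob V hV t n) = 1 := by
  simp_rw [prob_eq, ← enorm_sq_eq_ofReal]
  rw [tsum_enorm_sq, norm_psi]
  simp

/-- Since e < (5/4)^5, one has e^{2t} ≤ (5/4)^{10t}. Beyond 10t one of the two geometric factors
therefore pays for the growth e^{2t}, and the other remains for summation. -/
theorem exp_two_mul_geometric_le {t : ℝ} {N : ℕ} (h : 10 * t ≤ N) :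
    Real.exp t ^ 2 * ((4 / 5 : ℝ) ^ N) ^ 2 ≤ (4 / 5) ^ N := by
  have h1 : Real.exp (1 / 5) ≤ 5 / 4 := by
    refine le_of_pow_le_pow_left₀ (n := 5) (by norm_num) (by norm_num) ?_
    rw [← Real.exp_nat_mul]
    norm_num
    linarith [Real.exp_one_lt_d9]
  have h2 : Real.exp t ^ 2 ≤ (5 / 4) ^ N :=
    calc Real.exp t ^ 2 = Real.exp (2 * t) := by rw [← Real.exp_nat_mul]; norm_num
      _ ≤ Real.exp (N * (1 / 5)) := Real.exp_le_exp.2 (by linarith)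
      _ = Real.exp (1 / 5) ^ N := Real.exp_nat_mul _ _
      _ ≤ _ := by gcongr
  calc _ ≤ (5 / 4 : ℝ) ^ N * ((4 / 5 : ℝ) ^ N) ^ 2 := by gcongr
    _ = (5 / 4 * (4 / 5)) ^ N * (4 / 5 : ℝ) ^ N := by rw [mul_pow]; ring
    _ = _ := by norm_num

theorem summable_pow_mul_geometric_natAbs (k : ℕ) :
    Summable fun n : ℤ => (n.natAbs : ℝ) ^ k * (4 / 5 : ℝ) ^ n.natAbs := by
  have hg : Summable fun n : ℕ => (n : ℝ) ^ k * (4 / 5 : ℝ) ^ n :=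
    summable_pow_mul_geometric_of_norm_lt_one k (by rw [Real.norm_eq_abs, abs_of_pos] <;> norm_num)
  refine Summable.of_nat_of_neg ?_ ?_
  · simpa only [Int.natAbs_natCast] using hg
  · simpa only [Int.natAbs_neg, Int.natAbs_natCast] using hg

/-- The moment is controlled by the outside probability beyond `t ^ a`, up to constants. -/
theorem exists_moment_le {V : ℤ → ℝ} (hV : ∃ M : ℝ, ∀ n, |V n| ≤ M) {K : ℝ} (hK : 1 ≤ K)
    (hH : ‖hamiltonian V hV‖ ≤ K - 1) {p : ℝ} (hp : 0 < p) :
    ∃ R : ℝ, 0 ≤ R ∧ ∀ a t : ℝ, 0 < t → moment V hV p t ≤ ENNReal.ofReal ((t ^ a) ^ p) +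
      ENNReal.ofReal ((10 * t) ^ p) * probOutside V hV (t ^ a - 1) t + ENNReal.ofReal R := by
  obtain ⟨C, hC0, hC⟩ := exists_norm_psi_le hV hK hH
  obtain ⟨k, hk⟩ := exists_nat_ge p
  have hsum : Summable fun n : ℤ => C ^ 2 * ((n.natAbs : ℝ) ^ k * (4 / 5) ^ n.natAbs) :=
    (summable_pow_mul_geometric_natAbs k).mul_left _
  refine ⟨∑' n : ℤ, C ^ 2 * ((n.natAbs : ℝ) ^ k * (4 / 5) ^ n.natAbs),
    tsum_nonneg fun n => by positivity, fun a t ht => ?_⟩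
  set pr : ℤ → ℝ≥0∞ := fun n => ENNReal.ofReal (prob V hV t n) with hpr
  have hp0 : ∀ n, 0 ≤ prob V hV t n := fun n => by rw [prob]; positivity
  set SL : Set ℤ := {n | (n : ℝ) ≤ -(t ^ a - 1)}
  set SR : Set ℤ := {n | t ^ a - 1 ≤ (n : ℝ)}
  have hP : probOutside V hV (t ^ a - 1) t = ∑' n, (SL.indicator pr n + SR.indicator pr n) := by
    rw [ENNReal.tsum_add, ← tsum_subtype, ← tsum_subtype]
    rfl
  rw [hP, ENNReal.ofReal_tsum_of_nonneg (fun n => by positivity) hsum, ← ENNReal.tsum_mul_left,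
    ← mul_one (ENNReal.ofReal ((t ^ a) ^ p)), ← tsum_prob V hV t, ← ENNReal.tsum_mul_left,
    ← ENNReal.tsum_add, ← ENNReal.tsum_add]
  refine ENNReal.tsum_le_tsum fun n => ?_
  have habs := natAbs_cast_eq_abs n
  -- Each site is charged to one of the three terms: |n| < t^a, then |n| ≤ 10t, then the ballistic
  -- region. No comparison of t^a with 10t is needed.
  by_cases h1 : |(n : ℝ)| < t ^ a
  · rw [add_assoc]
    refine le_add_right ?_
    rw [← ENNReal.ofReal_mul (by positivity)]
    exact ENNReal.ofReal_le_ofReal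
      (mul_le_mul_of_nonneg_right (Real.rpow_le_rpow (abs_nonneg _) h1.le hp.le) (hp0 n))
  by_cases h2 : |(n : ℝ)| ≤ 10 * t
  · refine le_add_right (le_add_left ?_)
    have h3 : pr n ≤ SL.indicator pr n + SR.indicator pr n := by
      rcases le_abs'.1 (not_lt.1 h1) with h | h
      · rw [Set.indicator_of_mem (show n ∈ SL from by
          show (n : ℝ) ≤ -(t ^ a - 1)
          linarith)]
        exact le_self_add
      · rw [Set.indicator_of_mem (s := SR) (show n ∈ SR from by
          show t ^ a - 1 ≤ (n : ℝ)
          linarith)]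
        exact le_add_self
    refine le_trans ?_ (mul_le_mul_right h3 _)
    rw [hpr, ← ENNReal.ofReal_mul (by positivity)]
    exact ENNReal.ofReal_le_ofReal
      (mul_le_mul_of_nonneg_right (Real.rpow_le_rpow (abs_nonneg _) h2 hp.le) (hp0 n))
  · refine le_add_left (ENNReal.ofReal_le_ofReal ?_)
    have hn : n ≠ 0 := fun h0 => h2 (by rw [h0]; simp; linarith)
    have hn1 : (1 : ℝ) ≤ n.natAbs := by exact_mod_cast Int.natAbs_pos.2 hn
    have h3 : prob V hV t n ≤ C ^ 2 * (4 / 5) ^ n.natAbs := by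
      rw [prob_eq]
      calc _ ≤ (C * Real.exp t * (4 / 5) ^ n.natAbs) ^ 2 := by gcongr; exact hC t ht n hn
        _ = C ^ 2 * (Real.exp t ^ 2 * ((4 / 5) ^ n.natAbs) ^ 2) := by ring
        _ ≤ _ := by
          gcongr
          exact exp_two_mul_geometric_le (by rw [habs]; linarith)
    have h4 : |(n : ℝ)| ^ p ≤ (n.natAbs : ℝ) ^ k := by
      rw [← habs, ← Real.rpow_natCast]
      exact Real.rpow_le_rpow_of_exponent_le hn1 hk
    calc _ ≤ (n.natAbs : ℝ) ^ k * (C ^ 2 * (4 / 5) ^ n.natAbs) :=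
          mul_le_mul h4 h3 (hp0 n) (by positivity)
      _ = _ := by ring

/-! ### Transport exponents -/

theorem log_div_le {x : ℝ≥0∞} {y L r : ℝ} (hy : 0 < y) (hL : 0 < L)
    (hx : x ≤ ENNReal.ofReal y) (hr : Real.log y / L ≤ r) :
    ENNReal.log x / (L : EReal) ≤ (r : EReal) := by
  have h1 : ENNReal.log x ≤ (Real.log y : EReal) := by
    rw [← ENNReal.log_ofReal_of_pos hy]
    exact ENNReal.log_le_log hx
  refine (EReal.div_le_div_right_of_nonneg (by exact_mod_cast hL.le) h1).trans ?_
  rw [← EReal.coe_div]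
  exact_mod_cast hr

/-- The limsup is at most -m for every m. Vanishing probabilities are harmless because their
logarithm is -∞. -/
theorem SPlus_eq_top {V : ℤ → ℝ} (hV : ∃ M : ℝ, ∀ n, |V n| ≤ M) {a : ℝ}
    (h : ∀ m : ℕ, ∀ᶠ t in atTop,
      probOutside V hV (t ^ a - 1) t ≤ ENNReal.ofReal ((t ^ m)⁻¹)) : SPlus V hV a = ⊤ := by
  rw [SPlus, EReal.neg_eq_top_iff, EReal.eq_bot_iff_forall_lt]
  intro y
  obtain ⟨m, hm⟩ := exists_nat_gt (-y)
  have hlt : ((-(m : ℝ) : ℝ) : EReal) < (y : EReal) := by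
    exact_mod_cast (show -(m : ℝ) < y by linarith)
  refine lt_of_le_of_lt (limsup_le_of_le (h := ?_)) hlt
  filter_upwards [h m, eventually_gt_atTop 1] with t h1 h2
  have hlog := Real.log_pos h2
  refine log_div_le (by positivity) hlog h1 (le_of_eq ?_)
  rw [Real.log_inv, Real.log_pow]
  field_simp

/-- Decay of order ⌈p⌉ already cancels (10t)^p, so the moment is at most a constant times t^{ap}.
The gap between a and b absorbs the constant. -/
theorem betaPlus_le {V : ℤ → ℝ} (hV : ∃ M : ℝ, ∀ n, |V n| ≤ M) {K : ℝ} (hK : 1 ≤ K)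
    (hH : ‖hamiltonian V hV‖ ≤ K - 1) {p a b : ℝ} (hp : 0 < p) (ha : 0 < a) (hab : a < b)
    (h : ∀ m : ℕ, ∀ᶠ t in atTop,
      probOutside V hV (t ^ a - 1) t ≤ ENNReal.ofReal ((t ^ m)⁻¹)) :
    betaPlus V hV p ≤ (b : EReal) := by
  obtain ⟨R, hR0, hR⟩ := exists_moment_le hV hK hH hp
  refine limsup_le_of_le (h := ?_)
  -- The three terms of the moment bound total at most (1 + 10^p + R) t^{ap}, because t^{ap} ≥ 1.
  have hlt := eventually_lt_rpow_sub_one (C := 1 + 10 ^ p + R) (mul_pos ha hp)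
    (mul_lt_mul_of_pos_right hab hp)
  filter_upwards [h ⌈p⌉₊, eventually_gt_atTop 1, hlt] with t h1 h2 h3
  have ht : 0 < t := by linarith
  have hlog := Real.log_pos h2
  have h4 : (10 * t) ^ p * (t ^ ⌈p⌉₊)⁻¹ ≤ 10 ^ p := by
    rw [Real.mul_rpow (by norm_num) ht.le, mul_assoc]
    refine mul_le_of_le_one_right (by positivity) ?_
    rw [← div_eq_mul_inv, div_le_one (by positivity), ← Real.rpow_natCast]
    exact Real.rpow_le_rpow_of_exponent_le h2.le (Nat.le_ceil p)
  have h5 : 1 ≤ t ^ (a * p) := Real.one_le_rpow h2.le (by positivity)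
  have h6 : moment V hV p t ≤ ENNReal.ofReal (t ^ (b * p)) := by
    refine (hR a t ht).trans ?_
    refine (add_le_add_left (add_le_add_right (mul_le_mul_right h1 _) _) _).trans ?_
    rw [← ENNReal.ofReal_mul (by positivity), ← ENNReal.ofReal_add (by positivity) (by positivity),
      ← ENNReal.ofReal_add (by positivity) hR0, ← Real.rpow_mul ht.le]
    refine ENNReal.ofReal_le_ofReal ?_
    have h10 : (0 : ℝ) ≤ 10 ^ p := by positivity
    nlinarith
  refine log_div_le (by positivity) (mul_pos hp hlog) h6 (le_of_eq ?_)
  rw [Real.log_rpow ht]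
  field_simp

end Schrodinger

end

theorem corollary1 (V : ℤ → ℝ) (hV : ∃ M : ℝ, ∀ n, |V n| ≤ M) (K : ℝ) (hK : 4 ≤ K)
    (hspec : spectrum ℂ (Schrodinger.hamiltonian V hV) ⊆
      (fun x : ℝ => (x : ℂ)) '' Set.Icc (-K + 1) (K - 1))
    (C α : ℝ) (hC : 0 < C) (hα : α ∈ Set.Ioo (0 : ℝ) 1)
    (hright : ∀ m : ℕ, 1 ≤ m →
      (fun t : ℝ => ∫ E in (-K)..K,
        ((Schrodinger.maxRight V ((E : ℂ) + Complex.I * ((t⁻¹ : ℝ) : ℂ)) (C * t ^ α) : ℝ))⁻¹)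
        =O[atTop] fun t : ℝ => (t ^ m)⁻¹)
    (hleft : ∀ m : ℕ, 1 ≤ m →
      (fun t : ℝ => ∫ E in (-K)..K,
        ((Schrodinger.maxLeft V ((E : ℂ) + Complex.I * ((t⁻¹ : ℝ) : ℂ)) (C * t ^ α) : ℝ))⁻¹)
        =O[atTop] fun t : ℝ => (t ^ m)⁻¹) :
    Schrodinger.alphaUPlus V hV ≤ (α : EReal) ∧
      ∀ p : ℝ, 0 < p → Schrodinger.betaPlus V hV p ≤ (α : EReal) := by
  have hK1 : 1 ≤ K := by linarith
  have hH := Schrodinger.norm_hamiltonian_le V hV hK1 hspec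
  have hP : ∀ a : ℝ, α < a → ∀ m : ℕ, ∀ᶠ t in atTop,
      Schrodinger.probOutside V hV (t ^ a - 1) t ≤ ENNReal.ofReal ((t ^ m)⁻¹) :=
    fun a ha => Schrodinger.eventually_probOutside_le hV hK1 hH hC hα.1 hright hleft ha
  refine ⟨sSup_le ?_, fun p hp => ?_⟩
  · rintro _ ⟨a, rfl, -, hS⟩
    by_contra hlt
    have ha : α < a := by
      rw [not_le] at hlt
      exact_mod_cast hlt
    exact hS.ne (Schrodinger.SPlus_eq_top hV (hP a ha))
  · refine EReal.le_of_forall_lt_iff_le.1 fun b hb => ?_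
    have hb' : α < b := by exact_mod_cast hb
    obtain ⟨a, ha1, ha2⟩ := exists_between hb'
    exact Schrodinger.betaPlus_le hV hK1 hH hp (hα.1.trans ha1) ha2 (hP a ha1)
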